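/- Let $k$ be an algebraically closed field (for instance $k=\mathbb{C}$). Dynkin diagrams are non-empty, connected and of finite type. Let $D$ be a simply-laced Dynkin diagram with vertex set $I_D$ and Cartan matrix $C=(C_{ij})$. An automorphism $a$ of $D$ is called admissible if two vertices of the same $a$-orbit are never joined by an edge. For an admissible $a$, the foldings $D'$ and $D''$ are the Dynkin diagrams whose Cartan matrices, indexed by the set $I_D/a$ of orbits, are $$C'_{\mathbf{i}\mathbf{j}}=\frac{1}{\#\mathbf{i}}\sum_{(i,j)\in\mathbf{i}\times\mathbf{j}}C_{ij},\qquad C''_{\mathbf{i}\mathbf{j}}=\frac{1}{\#\mathbf{j}}\sum_{(i,j)\in\mathbf{i}\times\mathbf{j}}C_{ij}.$$ For a finite quiver $Q$, the preprojective algebra of $Q$ over $k$ is the quotient of the path algebra over $k$ of the double quiver of $Q$ (an arrow $\alpha^*:j\to i$ is added for each arrow $\alpha:i\to j$ of $Q$) by the ideal generated by $\sum_{\alpha}(\alpha\alpha^*-\alpha^*\alpha)$. For a group $\Gamma$ acting on a $k$-algebra $A$ by $k$-algebra automorphisms, the skew group algebra $A\Gamma$ is $A\otimes_{\mathbb{Z}}\mathbb{Z}[\Gamma]$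 with the multiplication $(x\otimes g)(y\otimes h)=x\,g(y)\otimes gh$. For a $k$-algebra $A$, $\operatorname{mod}A$ is the category of finite-dimensional left $A$-modules. **Proposition.** Let $\Delta$ be a Dynkin diagram. Let $\Delta_1,\Delta_2$ be simply-laced Dynkin diagrams and let $a_1,a_2$ be admissible automorphisms of $\Delta_1,\Delta_2$ such that $\Delta_1'=\Delta_2''=\Delta$ (equality of Cartan matrices up to relabelling of the vertices). Assume that the order of $a_1$ is non-zero in $k$ (which is automatic for $k=\mathbb{C}$). Let $Q_1$ and $Q_2$ be orientations of $\Delta_1$ and $\Delta_2$ that are preserved by $a_1$ and $a_2$ respectively, and let $\Lambda_1$ and $\Lambda_2$ be the preprojective algebras of $Q_1$ and $Q_2$ over $k$. Let $\Gamma_1=\langle a_1\rangle$ be the group of automorphisms of $\Delta_1$ generated by $a_1$, acting on $\Lambda_1$ by permuting vertices and arrows ($g(\alpha^*)=(g\alpha)^*$). Then there is a ($k$-linear) equivalence of categories $$\Phi:\operatorname{mod}\Lambda_1\Gamma_1\longrightarrow\operatorname{mod}\Lambda_2 .$$ -/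

import Mathlib

open CategoryTheory

universe u v

/-! ### Dynkin diagrams, automorphisms and foldings -/

/-- `C` is the Cartan matrix of a (connected) Dynkin diagram with vertex set `I`: an indecomposable
generalized Cartan matrix of finite type, that is, some `diag(d) * C` with positive `d` is symmetric
and positive definite. -/
structure IsDynkinCartanMatrix {I : Type*} [Finite I] (C : Matrix I I ℤ) : Prop where
  diag : ∀ i, C i i = 2
  offDiag : ∀ i j, i ≠ j → C i j ≤ 0
  connected : (SimpleGraph.fromRel fun i j => C i j ≠ 0).Connected
  posDef : ∃ d : I → ℝ, (∀ i, 0 < d i) ∧ (Matrix.of fun i j => d i * (C i j : ℝ)).PosDef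

open Classical in
/-- The Cartan matrix of a simply-laced diagram, given as a simple graph. -/
noncomputable def SimpleGraph.cartanMatrix {I : Type*} (Δ : SimpleGraph I) : Matrix I I ℤ :=
  Matrix.of fun i j => if i = j then 2 else if Δ.Adj i j then -1 else 0

/-- A simple graph is a simply-laced Dynkin diagram (type `A`, `D`, `E`). -/
def SimpleGraph.IsDynkin {I : Type*} [Finite I] (Δ : SimpleGraph I) : Prop :=
  IsDynkinCartanMatrix Δ.cartanMatrix

/-- A diagram automorphism is admissible if two vertices of the same orbit are never joined
by an edge. -/
def SimpleGraph.IsAdmissible {I : Type*} {Δ : SimpleGraph I} (a : Δ ≃g Δ) : Prop :=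
  ∀ i j, Equiv.Perm.SameCycle a.toEquiv i j → ¬ Δ.Adj i j

/-- The set `I/a` of orbits of vertices. -/
abbrev SimpleGraph.Orbits {I : Type*} {Δ : SimpleGraph I} (a : Δ ≃g Δ) : Type _ :=
  Quotient (Equiv.Perm.SameCycle.setoid a.toEquiv)

open Classical in
/-- The vertices that belong to a given orbit. -/
noncomputable def SimpleGraph.orbitVertices {I : Type*} [Fintype I] {Δ : SimpleGraph I}
    (a : Δ ≃g Δ) (x : SimpleGraph.Orbits a) : Finset I :=
  Finset.univ.filter fun i => (Quotient.mk _ i : SimpleGraph.Orbits a) = x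

/-- The folding `C'`, with entries `C'_{𝐢𝐣} = (1 / #𝐢) ∑_{(i, j) ∈ 𝐢 × 𝐣} C_{ij}`. -/
noncomputable def SimpleGraph.foldPrime {I : Type*} [Fintype I] {Δ : SimpleGraph I}
    (a : Δ ≃g Δ) : Matrix (SimpleGraph.Orbits a) (SimpleGraph.Orbits a) ℚ :=
  Matrix.of fun x y => (1 / ((SimpleGraph.orbitVertices a x).card : ℚ)) *
    ∑ i ∈ SimpleGraph.orbitVertices a x, ∑ j ∈ SimpleGraph.orbitVertices a y,
      (Δ.cartanMatrix i j : ℚ)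

/-- The folding `C''`, with entries `C''_{𝐢𝐣} = (1 / #𝐣) ∑_{(i, j) ∈ 𝐢 × 𝐣} C_{ij}`. -/
noncomputable def SimpleGraph.foldDoublePrime {I : Type*} [Fintype I] {Δ : SimpleGraph I}
    (a : Δ ≃g Δ) : Matrix (SimpleGraph.Orbits a) (SimpleGraph.Orbits a) ℚ :=
  Matrix.of fun x y => (1 / ((SimpleGraph.orbitVertices a y).card : ℚ)) *
    ∑ i ∈ SimpleGraph.orbitVertices a x, ∑ j ∈ SimpleGraph.orbitVertices a y,
      (Δ.cartanMatrix i j : ℚ)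

/-- A rational matrix, indexed by a finite set, is the integral matrix `C` up to relabelling
of the index set. -/
def IsCartanMatrixOf {O I : Type*} (M : Matrix O O ℚ) (C : Matrix I I ℤ) : Prop :=
  ∃ e : O ≃ I, ∀ x y, M x y = (C (e x) (e y) : ℚ)

/-- An orientation of `Δ` (for each edge, exactly one of the two directions is chosen) that is
compatible with, i.e. preserved by, the automorphism `a`. -/
structure CompatibleOrientation {I : Type*} (Δ : SimpleGraph I) (a : Δ ≃g Δ)
    extends Digraph I where
  adj_iff : ∀ i j, Δ.Adj i j ↔ (Adj i j ∨ Adj j i)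
  asymm : ∀ i j, Adj i j → ¬ Adj j i
  compatible : ∀ i j, Adj (a i) (a j) ↔ Adj i j

/-! ### Preprojective algebras -/

/-- The arrows `i ⟶ j` of a quiver without multiple arrows. -/
abbrev Digraph.Arrow {V : Type*} (Q : Digraph V) : Type _ := {p : V × V // Q.Adj p.1 p.2}

/-- Generators of the path algebra of the double quiver of `Q`: the trivial paths `e_i`, the arrows
`α : i ⟶ j` of `Q` and the reverse arrows `α* : j ⟶ i`. -/
inductive PreprojGen {V : Type v} (Q : Digraph V) : Type v
  | vertex (i : V)
  | arrow (α : Q.Arrow)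
  | star (α : Q.Arrow)

section Preproj

variable (k : Type u) [Field k] {V : Type v} [Fintype V] (Q : Digraph V)

local notation "ε" => fun i => FreeAlgebra.ι k (PreprojGen.vertex (Q := Q) i)
local notation "ρ" => fun α => FreeAlgebra.ι k (PreprojGen.arrow (Q := Q) α)
local notation "σ" => fun α => FreeAlgebra.ι k (PreprojGen.star (Q := Q) α)

open Classical in
/-- Defining relations of the preprojective algebra. All but the last present the path algebra of
the double quiver, where `x * y` is the path `y` followed by `x`; the last one is the
preprojective relation `∑_α (α α* - α* α) = 0`. -/
inductive PreprojRel : FreeAlgebra k (PreprojGen Q) → FreeAlgebra k (PreprojGen Q) → Prop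
  | vertex_mul_self (i : V) : PreprojRel (ε i * ε i) (ε i)
  | vertex_mul_vertex (i j : V) (h : i ≠ j) : PreprojRel (ε i * ε j) 0
  | sum_vertex : PreprojRel (∑ i, ε i) 1
  | target_mul_arrow (α : Q.Arrow) : PreprojRel (ε α.1.2 * ρ α) (ρ α)
  | arrow_mul_source (α : Q.Arrow) : PreprojRel (ρ α * ε α.1.1) (ρ α)
  | source_mul_star (α : Q.Arrow) : PreprojRel (ε α.1.1 * σ α) (σ α)
  | star_mul_target (α : Q.Arrow) : PreprojRel (σ α * ε α.1.2) (σ α)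
  | preprojective : PreprojRel (∑ α : Q.Arrow, (ρ α * σ α - σ α * ρ α)) 0

/-- The preprojective algebra `Λ` over `k` of a finite quiver `Q` without multiple arrows. -/
abbrev Preproj : Type (max u v) := RingQuot (PreprojRel k Q)

namespace Preproj

/-- The image of a generator in the preprojective algebra. -/
noncomputable def gen (x : PreprojGen Q) : Preproj k Q :=
  RingQuot.mkAlgHom k (PreprojRel k Q) (FreeAlgebra.ι k x)

variable {Q}

/-- The action of an automorphism of `Q` on arrows. -/
def mapArrow (f : Q.Adj ≃r Q.Adj) (α : Q.Arrow) : Q.Arrow :=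
  ⟨(f α.1.1, f α.1.2), f.map_rel_iff.2 α.2⟩

/-- The action of an automorphism of `Q` on the generators. -/
def mapGen (f : Q.Adj ≃r Q.Adj) : PreprojGen Q → PreprojGen Q
  | .vertex i => .vertex (f i)
  | .arrow α => .arrow (mapArrow f α)
  | .star α => .star (mapArrow f α)

/-- Automorphisms of `Q` permute the arrows. -/
def arrowEquiv (f : Q.Adj ≃r Q.Adj) : Q.Arrow ≃ Q.Arrow where
  toFun := mapArrow f
  invFun := mapArrow f.symm
  left_inv α := by simp [mapArrow]
  right_inv α := by simp [mapArrow]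

lemma rel_mapGen (f : Q.Adj ≃r Q.Adj) {x y : FreeAlgebra k (PreprojGen Q)}
    (h : PreprojRel k Q x y) :
    FreeAlgebra.lift k (fun z => gen k Q (mapGen f z)) x =
      FreeAlgebra.lift k (fun z => gen k Q (mapGen f z)) y := by
  classical
  have key : ∀ {x y}, PreprojRel k Q x y →
      RingQuot.mkAlgHom k (PreprojRel k Q) x = RingQuot.mkAlgHom k (PreprojRel k Q) y :=
    fun h => RingQuot.mkAlgHom_rel k h
  cases h with
  | vertex_mul_self i => simpa [gen, mapGen] using key (.vertex_mul_self (f i))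
  | vertex_mul_vertex i j h =>
    simpa [gen, mapGen] using key (.vertex_mul_vertex (f i) (f j) (f.injective.ne h))
  | sum_vertex =>
    have := key PreprojRel.sum_vertex
    rw [← Equiv.sum_comp f.toEquiv] at this
    simpa [gen, mapGen] using this
  | target_mul_arrow α => simpa [gen, mapGen, mapArrow] using key (.target_mul_arrow (mapArrow f α))
  | arrow_mul_source α => simpa [gen, mapGen, mapArrow] using key (.arrow_mul_source (mapArrow f α))
  | source_mul_star α => simpa [gen, mapGen, mapArrow] using key (.source_mul_star (mapArrow f α))
  | star_mul_target α => simpa [gen, mapGen, mapArrow] using key (.star_mul_target (mapArrow f α))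
  | preprojective =>
    have := key PreprojRel.preprojective
    rw [← Equiv.sum_comp (arrowEquiv f)] at this
    simpa [gen, mapGen, arrowEquiv] using this

/-- The algebra endomorphism of `Λ` induced by an automorphism of the quiver. -/
noncomputable def map (f : Q.Adj ≃r Q.Adj) : Preproj k Q →ₐ[k] Preproj k Q :=
  RingQuot.liftAlgHom k ⟨FreeAlgebra.lift k (fun z => gen k Q (mapGen f z)),
    fun _ _ h => rel_mapGen k f h⟩

@[simp]
lemma map_gen (f : Q.Adj ≃r Q.Adj) (x : PreprojGen Q) :
    map k f (gen k Q x) = gen k Q (mapGen f x) := by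
  simp [map, gen]

lemma algHom_ext {A : Type*} [Semiring A] [Algebra k A] {f g : Preproj k Q →ₐ[k] A}
    (h : ∀ x, f (gen k Q x) = g (gen k Q x)) : f = g := by
  apply RingQuot.ringQuot_ext'
  apply FreeAlgebra.hom_ext
  funext x
  exact h x

lemma map_one : map k (1 : Q.Adj ≃r Q.Adj) = AlgHom.id k _ := by
  apply algHom_ext
  rintro (i | α | α) <;> simp [mapGen, mapArrow]

lemma map_mul (f g : Q.Adj ≃r Q.Adj) : map k (f * g) = (map k f).comp (map k g) := by
  apply algHom_ext
  rintro (i | α | α) <;> simp [mapGen, mapArrow]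

end Preproj

end Preproj

/-! ### The action of `⟨a⟩` on the preprojective algebra, and the skew group algebra -/

section Action

variable {I : Type v} {Δ : SimpleGraph I} {a : Δ ≃g Δ}

namespace CompatibleOrientation

/-- The diagram automorphisms that preserve the orientation `Q`. -/
def stabilizer (Q : CompatibleOrientation Δ a) : Subgroup (Δ ≃g Δ) where
  carrier := {g | ∀ i j, Q.Adj (g i) (g j) ↔ Q.Adj i j}
  one_mem' := fun i j => by simp
  mul_mem' := fun {g h} hg hh i j => by
    simpa using (hg (h i) (h j)).trans (hh i j)
  inv_mem' := fun {g} hg i j => by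
    simpa [← RelIso.mul_apply] using (hg (g⁻¹ i) (g⁻¹ j)).symm

lemma zpowers_le_stabilizer (Q : CompatibleOrientation Δ a) :
    Subgroup.zpowers a ≤ Q.stabilizer :=
  (Subgroup.zpowers_le).2 Q.compatible

/-- The group generated by `a` acts on the quiver. -/
def quiverAut (Q : CompatibleOrientation Δ a) :
    Subgroup.zpowers a →* (Q.Adj ≃r Q.Adj) where
  toFun g := ⟨g.1.toEquiv, fun {i j} => Q.zpowers_le_stabilizer g.2 i j⟩
  map_one' := by ext; rfl
  map_mul' g h := by ext; rfl

variable (k : Type u) [Field k] [Fintype I] (Q : CompatibleOrientation Δ a)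

/-- The group generated by `a` acts on the preprojective algebra: `g • e_i = e_{g i}`, and
`g • α = g α`, `g • α* = (g α)*` for each arrow `α`. -/
noncomputable instance : MulSemiringAction (Subgroup.zpowers a) (Preproj k Q.toDigraph) where
  smul g x := Preproj.map k (Q.quiverAut g) x
  one_smul x := by
    change Preproj.map k (Q.quiverAut 1) x = x
    rw [_root_.map_one, Preproj.map_one]; rfl
  mul_smul g h x := by
    change Preproj.map k (Q.quiverAut (g * h)) x = _
    rw [_root_.map_mul, Preproj.map_mul]; rfl
  smul_zero g := _root_.map_zero (Preproj.map k (Q.quiverAut g))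
  smul_add g := _root_.map_add (Preproj.map k (Q.quiverAut g))
  smul_one g := _root_.map_one (Preproj.map k (Q.quiverAut g))
  smul_mul g := _root_.map_mul (Preproj.map k (Q.quiverAut g))

lemma smul_def (g : Subgroup.zpowers a) (x : Preproj k Q.toDigraph) :
    g • x = Preproj.map k (Q.quiverAut g) x := rfl

instance : SMulCommClass (Subgroup.zpowers a) k (Preproj k Q.toDigraph) where
  smul_comm g c x := _root_.map_smul (Preproj.map k (Q.quiverAut g)) c x

/-- The preprojective algebra `Λ` of a compatible orientation. -/
abbrev preprojectiveAlgebra : Type (max u v) := Preproj k Q.toDigraph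

/-- The skew group algebra `ΛΓ` of the preprojective algebra `Λ` and the group `Γ = ⟨a⟩`:
finite sums of symbols `x ⊗ g` multiplied by `(x ⊗ g) (y ⊗ h) = x (g • y) ⊗ g h`. -/
abbrev skewGroupAlgebra : Type (max u v) :=
  SkewMonoidAlgebra (Preproj k Q.toDigraph) (Subgroup.zpowers a)

end CompatibleOrientation

end Action

/-! ### Module categories -/

section ModuleCategories

open scoped ModuleCat.Algebra

/-- The finite-dimensional (left) modules over a `k`-algebra `A`. -/
def ModuleCat.isFinDim (k : Type*) [Field k] (A : Type*) [Ring A] [Algebra k A] :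
    ObjectProperty (ModuleCat.{v} A) :=
  fun M => Module.Finite k M

/-- The category `mod A` of finite-dimensional (left) modules over a `k`-algebra `A`. -/
abbrev FinDimModuleCat (k : Type*) [Field k] (A : Type*) [Ring A] [Algebra k A] :=
  (ModuleCat.isFinDim.{v} k A).FullSubcategory

noncomputable instance (k : Type*) [Field k] (A : Type*) [Ring A] [Algebra k A] :
    Linear k (FinDimModuleCat.{v} k A) :=
  Linear.fullSubcategory (ModuleCat.isFinDim.{v} k A)

end ModuleCategories

/-! Let `n` be the order of `a₁`, let Γ be the group generated by `a₁`, and let A = Λ₁Γ.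

Combinatorially, the two foldings are dual. The graph of `C` is a tree, so it lifts to base points
`x i` in Δ₁ and `y i` in Δ₂, and every edge upstairs is a translate of a lifted edge. The lengths of
the two orbits over `i` have product `n`. Hence Δ₂ has as many vertices over `i` as the stabilizer
of `x i` has elements. For a primitive `n`-th root of unity ζ, the vertex a₂^t (y i) corresponds to
the character a₁^m ↦ ζ^(mt) of this stabilizer. Two vertices of Δ₂ over neighbouring points of the
tree are joined exactly if their characters agree on the common stabilizer. This is the content of
`OrbitDuality`, obtained in `SimpleGraph.IsFolding.nonempty_orbitDuality`.

Algebraically, the sum ε of the idempotents of the base points is a full idempotent of A. The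
character idempotents of the stabilizers split ε into pieces indexed by the vertices of Δ₂. The
arrows of Λ₁ between base points, compressed to these pieces, satisfy the relations of Λ₂ up to
weights (`OrbitDuality.cornerFamily`): signs of the orientation divided by the orders of common
stabilizers. Such weights are antisymmetric and non-zero on edges, so a rescaling of the reversed
arrows absorbs them; this also makes the choice of orientation immaterial. The result is a
homomorphism φ : Λ₂ → εAε, surjective by `OrbitDuality.exists_cornerVal_eq`.

The equivalence is M ↦ εM, viewed as a Λ₂-module through φ. It is faithful because ε is full, and
full because moreover φ is surjective. Injectivity of φ is not proved directly. Instead, each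
Λ₂-module N is realized as a corner: the functions Γ → N that are equivariant for the stabilizers
form an A-module (`OrbitDuality.isSkewFamily_induced`), and evaluation at 1 identifies its corner
with N. -/

/-! ### Preprojective relations with weights -/

/-- A family of elements `e i`, `a i j` of an algebra that satisfies the relations of the
preprojective algebra of the graph `adj`, with the signs replaced by weights `τ`;
`a i j` is the arrow from `j` to `i`. -/
structure IsPreprojFamily {k : Type*} [Field k] {V : Type*} [Fintype V] (adj : V → V → Prop)
    (τ : V → V → k) {R : Type*} [Semiring R] [Algebra k R] (e : V → R) (a : V → V → R) : Prop where
  mul_self : ∀ i, e i * e i = e i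
  mul_of_ne : ∀ i j, i ≠ j → e i * e j = 0
  sum_eq_one : ∑ i, e i = 1
  vertex_mul : ∀ i j, e i * a i j = a i j
  mul_vertex : ∀ i j, a i j * e j = a i j
  eq_zero : ∀ i j, ¬ adj i j → a i j = 0
  rel : ∀ i, ∑ j, τ i j • (a i j * a j i) = 0

namespace IsPreprojFamily

variable {k : Type u} [Field k] {V : Type v} [Fintype V] {adj : V → V → Prop}
  {τ : V → V → k} {R : Type*} [Semiring R] [Algebra k R] {e : V → R} {a : V → V → R}

lemma vertex_mul_of_ne (h : IsPreprojFamily adj τ e a) {i j l : V} (hij : l ≠ i) :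
    e l * a i j = 0 := by
  rw [← h.vertex_mul, ← mul_assoc, h.mul_of_ne _ _ hij, zero_mul]

lemma mul_vertex_of_ne (h : IsPreprojFamily adj τ e a) {i j l : V} (hij : j ≠ l) :
    a i j * e l = 0 := by
  rw [← h.mul_vertex, mul_assoc, h.mul_of_ne _ _ hij, mul_zero]

lemma map (h : IsPreprojFamily adj τ e a) {S : Type*} [Semiring S] [Algebra k S] (f : R →ₐ[k] S) :
    IsPreprojFamily adj τ (fun i => f (e i)) (fun i j => f (a i j)) where
  mul_self i := by rw [← map_mul, h.mul_self]
  mul_of_ne i j hij := by rw [← map_mul, h.mul_of_ne _ _ hij, map_zero]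
  sum_eq_one := by rw [← map_sum, h.sum_eq_one, map_one]
  vertex_mul i j := by rw [← map_mul, h.vertex_mul]
  mul_vertex i j := by rw [← map_mul, h.mul_vertex]
  eq_zero i j hij := by rw [h.eq_zero _ _ hij, map_zero]
  rel i := by
    simpa only [map_sum, map_smul, map_mul, map_zero] using congrArg f (h.rel i)

end IsPreprojFamily

namespace Preproj

variable {k : Type u} [Field k] {V : Type v} [Fintype V] {Q : Digraph V} {adj : V → V → Prop}
  {τ : V → V → k} {R : Type*} [Semiring R] [Algebra k R] {e : V → R} {a : V → V → R}

lemma mkAlgHom_ι (x : PreprojGen Q) :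
    RingQuot.mkAlgHom k (PreprojRel k Q) (FreeAlgebra.ι k x) = gen k Q x := rfl

lemma vertex_mul_self (i : V) :
    gen k Q (.vertex i) * gen k Q (.vertex i) = gen k Q (.vertex i) := by
  simpa [mkAlgHom_ι] using RingQuot.mkAlgHom_rel k (PreprojRel.vertex_mul_self (k := k) (Q := Q) i)

lemma vertex_mul_vertex {i j : V} (h : i ≠ j) :
    gen k Q (.vertex i) * gen k Q (.vertex j) = 0 := by
  simpa [mkAlgHom_ι] using
    RingQuot.mkAlgHom_rel k (PreprojRel.vertex_mul_vertex (k := k) (Q := Q) i j h)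

lemma sum_vertex : ∑ i, gen k Q (.vertex i) = 1 := by
  simpa [mkAlgHom_ι] using RingQuot.mkAlgHom_rel k (PreprojRel.sum_vertex (k := k) (Q := Q))

lemma target_mul_arrow (α : Q.Arrow) :
    gen k Q (.vertex α.1.2) * gen k Q (.arrow α) = gen k Q (.arrow α) := by
  simpa [mkAlgHom_ι] using RingQuot.mkAlgHom_rel k (PreprojRel.target_mul_arrow (k := k) α)

lemma arrow_mul_source (α : Q.Arrow) :
    gen k Q (.arrow α) * gen k Q (.vertex α.1.1) = gen k Q (.arrow α) := by
  simpa [mkAlgHom_ι] using RingQuot.mkAlgHom_rel k (PreprojRel.arrow_mul_source (k := k) α)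

lemma source_mul_star (α : Q.Arrow) :
    gen k Q (.vertex α.1.1) * gen k Q (.star α) = gen k Q (.star α) := by
  simpa [mkAlgHom_ι] using RingQuot.mkAlgHom_rel k (PreprojRel.source_mul_star (k := k) α)

lemma star_mul_target (α : Q.Arrow) :
    gen k Q (.star α) * gen k Q (.vertex α.1.2) = gen k Q (.star α) := by
  simpa [mkAlgHom_ι] using RingQuot.mkAlgHom_rel k (PreprojRel.star_mul_target (k := k) α)

open Classical in
lemma preprojective : ∑ α : Q.Arrow, (gen k Q (.arrow α) * gen k Q (.star α) -
    gen k Q (.star α) * gen k Q (.arrow α)) = 0 := by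
  have := RingQuot.mkAlgHom_rel k (PreprojRel.preprojective (k := k) (Q := Q))
  simpa [mkAlgHom_ι] using this

open Classical in
/-- A sum over the arrows of an oriented graph, in both directions. -/
lemma sum_arrow_add_swap (hQ : ∀ i j, Q.Adj i j → ¬ Q.Adj j i) {M : Type*} [AddCommMonoid M]
    (F : V → V → M) (hF : ∀ i j, ¬ Q.Adj i j → ¬ Q.Adj j i → F i j = 0) :
    ∑ α : Q.Arrow, (F α.1.2 α.1.1 + F α.1.1 α.1.2) = ∑ i, ∑ j, F i j := by
  rw [Finset.sum_add_distrib]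
  have h1 : ∀ G : V × V → M, ∑ α : Q.Arrow, G α.1 =
      ∑ p : V × V, if Q.Adj p.1 p.2 then G p else 0 := by
    intro G
    rw [← Finset.sum_filter]
    exact (Finset.sum_subtype _ (fun p => by simp) G).symm
  rw [h1 (fun p => F p.2 p.1), h1 (fun p => F p.1 p.2), ← Finset.sum_product',
    ← (Equiv.prodComm V V).sum_comp (fun p => if Q.Adj p.1 p.2 then F p.2 p.1 else 0),
    ← Finset.sum_add_distrib]
  refine Finset.sum_congr rfl fun p _ => ?_
  obtain ⟨i, j⟩ := p
  simp only [Equiv.prodComm_apply, Prod.swap_prod_mk]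
  by_cases h : Q.Adj i j
  · simp [h, hQ _ _ h]
  · by_cases h' : Q.Adj j i
    · simp [h, h']
    · simp [h, h', hF]

/-- The images of the generators determined by a preprojective family. -/
def familyGen (τ : V → V → k) (e : V → R) (a : V → V → R) : PreprojGen Q → R
  | .vertex i => e i
  | .arrow α => a α.1.2 α.1.1
  -- As `τ` is antisymmetric, this factor turns α α* - α* α into the two terms of the weighted
  -- relation that belong to the edge of α.
  | .star α => τ α.1.2 α.1.1 • a α.1.1 α.1.2

open Classical in
/-- A preprojective family gives a homomorphism from the preprojective algebra. -/
noncomputable def ofFamily (hQ : ∀ i j, Q.Adj i j → ¬ Q.Adj j i)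
    (hadj : ∀ i j, adj i j ↔ Q.Adj i j ∨ Q.Adj j i) (hτ : ∀ i j, τ i j = - τ j i)
    (h : IsPreprojFamily adj τ e a) : Preproj k Q →ₐ[k] R :=
  RingQuot.liftAlgHom k ⟨FreeAlgebra.lift k (familyGen τ e a), by
    intro x y hxy
    cases hxy with
    | vertex_mul_self i => simpa [familyGen] using h.mul_self i
    | vertex_mul_vertex i j hij => simpa [familyGen] using h.mul_of_ne i j hij
    | sum_vertex => simpa [familyGen] using h.sum_eq_one
    | target_mul_arrow α => simpa [familyGen] using h.vertex_mul _ _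
    | arrow_mul_source α => simpa [familyGen] using h.mul_vertex _ _
    | source_mul_star α => simp [familyGen, h.vertex_mul]
    | star_mul_target α => simp [familyGen, h.mul_vertex]
    | preprojective =>
      -- The preprojective relation is the sum over all vertices of the weighted relations.
      have h1 := sum_arrow_add_swap hQ (fun i j => τ i j • (a i j * a j i)) (fun i j h1 h2 => by
        rw [h.eq_zero i j (by rw [hadj]; tauto), zero_mul, smul_zero])
      rw [Finset.sum_congr rfl fun i _ => h.rel i, Finset.sum_const_zero] at h1
      rw [map_zero, ← h1, map_sum]
      refine Finset.sum_congr rfl fun α _ => ?_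
      have hsub : ∀ (F : FreeAlgebra k (PreprojGen Q) →ₐ[k] R) x y,
          F (x - y) = F x + (-1 : k) • F y := fun F x y => by
        rw [← _root_.map_smul, ← _root_.map_add, neg_one_smul, sub_eq_add_neg]
      rw [hsub]
      simp [familyGen, hτ α.1.1 α.1.2, smul_smul]⟩

lemma ofFamily_gen (hQ : ∀ i j, Q.Adj i j → ¬ Q.Adj j i)
    (hadj : ∀ i j, adj i j ↔ Q.Adj i j ∨ Q.Adj j i) (hτ : ∀ i j, τ i j = - τ j i)
    (h : IsPreprojFamily adj τ e a) (x : PreprojGen Q) :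
    ofFamily hQ hadj hτ h (gen k Q x) = familyGen τ e a x := by
  simp [ofFamily, gen]

variable (k Q) in
/-- The idempotents of the preprojective algebra. -/
noncomputable def vertexElt (i : V) : Preproj k Q := gen k Q (.vertex i)

open Classical in
variable (Q) in
/-- The arrow from `j` to `i` in the preprojective algebra, or zero. -/
noncomputable def arrowElt (τ : V → V → k) (i j : V) : Preproj k Q :=
  if h : Q.Adj j i then gen k Q (.arrow ⟨(j, i), h⟩)
  else if h : Q.Adj i j then (τ j i)⁻¹ • gen k Q (.star ⟨(i, j), h⟩) else 0

lemma arrowElt_of_adj {i j : V} (h : Q.Adj j i) :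
    arrowElt Q τ i j = gen k Q (.arrow ⟨(j, i), h⟩) := by
  rw [arrowElt, dif_pos h]

lemma arrowElt_of_adj' (hQ : ∀ i j, Q.Adj i j → ¬ Q.Adj j i) {i j : V} (h : Q.Adj i j) :
    arrowElt Q τ i j = (τ j i)⁻¹ • gen k Q (.star ⟨(i, j), h⟩) := by
  rw [arrowElt, dif_neg (hQ _ _ h), dif_pos h]

/-- The relation at a vertex is the global preprojective relation multiplied by the idempotent of
that vertex. The inverse weight in `arrowElt` trades the signs ±1 for `τ`. -/
lemma isPreprojFamily (hQ : ∀ i j, Q.Adj i j → ¬ Q.Adj j i)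
    (hadj : ∀ i j, adj i j ↔ Q.Adj i j ∨ Q.Adj j i) (hτ : ∀ i j, τ i j = - τ j i)
    (hne : ∀ i j, adj i j → τ i j ≠ 0) :
    IsPreprojFamily adj τ (vertexElt k Q) (arrowElt Q τ) := by
  classical
  have hv : ∀ i j, vertexElt k Q i * arrowElt Q τ i j = arrowElt Q τ i j := by
    intro i j
    unfold arrowElt vertexElt
    split_ifs with h h
    · exact target_mul_arrow ⟨(j, i), h⟩
    · rw [mul_smul_comm]; congr 1; exact source_mul_star ⟨(i, j), h⟩
    · simp
  have hv' : ∀ i j, arrowElt Q τ i j * vertexElt k Q j = arrowElt Q τ i j := by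
    intro i j
    unfold arrowElt vertexElt
    split_ifs with h h
    · exact arrow_mul_source ⟨(j, i), h⟩
    · rw [smul_mul_assoc]; congr 1; exact star_mul_target ⟨(i, j), h⟩
    · simp
  refine ⟨fun i => vertex_mul_self i, fun i j h => vertex_mul_vertex h, sum_vertex, hv, hv', ?_, ?_⟩
  · intro i j h
    rw [hadj] at h
    rw [arrowElt, dif_neg (by tauto), dif_neg (by tauto)]
  · intro i
    have h1 := sum_arrow_add_swap hQ
      (fun i j => τ i j • (arrowElt Q τ i j * arrowElt Q τ j i)) (fun i j h1 h2 => by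
        rw [arrowElt, dif_neg h2, dif_neg h1, zero_mul, smul_zero])
    have h2 : ∑ α : Q.Arrow,
        (τ α.1.2 α.1.1 • (arrowElt Q τ α.1.2 α.1.1 * arrowElt Q τ α.1.1 α.1.2) +
        τ α.1.1 α.1.2 • (arrowElt Q τ α.1.1 α.1.2 * arrowElt Q τ α.1.2 α.1.1)) = 0 := by
      rw [← preprojective (k := k) (Q := Q)]
      refine Finset.sum_congr rfl fun α _ => ?_
      have hα : τ α.1.2 α.1.1 ≠ 0 := hne _ _ ((hadj _ _).2 (Or.inr α.2))
      rw [arrowElt_of_adj α.2, arrowElt_of_adj' hQ α.2, hτ α.1.1 α.1.2]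
      simp [hα, sub_eq_add_neg, smul_smul]
    rw [h2] at h1
    have h3 := congrArg (fun y => vertexElt k Q i * y) h1
    simp only [mul_zero, Finset.mul_sum] at h3
    rw [Finset.sum_eq_single i] at h3
    · rw [h3]
      refine Finset.sum_congr rfl fun j _ => ?_
      rw [mul_smul_comm, ← mul_assoc, hv]
    · intro l _ hl
      refine Finset.sum_eq_zero fun j _ => ?_
      rw [mul_smul_comm, ← hv l j, ← mul_assoc, ← mul_assoc]
      simp [vertexElt, vertex_mul_vertex hl.symm]
    · simp

lemma ofFamily_vertexElt (hQ : ∀ i j, Q.Adj i j → ¬ Q.Adj j i)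
    (hadj : ∀ i j, adj i j ↔ Q.Adj i j ∨ Q.Adj j i) (hτ : ∀ i j, τ i j = - τ j i)
    (h : IsPreprojFamily adj τ e a) (i : V) :
    ofFamily hQ hadj hτ h (vertexElt k Q i) = e i :=
  ofFamily_gen hQ hadj hτ h _

lemma ofFamily_arrowElt (hQ : ∀ i j, Q.Adj i j → ¬ Q.Adj j i)
    (hadj : ∀ i j, adj i j ↔ Q.Adj i j ∨ Q.Adj j i) (hτ : ∀ i j, τ i j = - τ j i)
    (hne : ∀ i j, adj i j → τ i j ≠ 0)
    (h : IsPreprojFamily adj τ e a) (i j : V) :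
    ofFamily hQ hadj hτ h (arrowElt Q τ i j) = a i j := by
  classical
  unfold arrowElt
  split_ifs with h1 h2
  · exact ofFamily_gen hQ hadj hτ h _
  · rw [map_smul, ofFamily_gen]
    simp [familyGen, smul_smul, inv_mul_cancel₀ (hne j i ((hadj _ _).2 (Or.inr h2)))]
  · rw [map_zero, h.eq_zero i j (by rw [hadj]; tauto)]

/-- The preprojective algebra is generated by the idempotents and the arrows. -/
lemma adjoin_eq_top (hQ : ∀ i j, Q.Adj i j → ¬ Q.Adj j i)
    (hadj : ∀ i j, adj i j ↔ Q.Adj i j ∨ Q.Adj j i)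
    (hne : ∀ i j, adj i j → τ i j ≠ 0) {S : Subalgebra k (Preproj k Q)}
    (hv : ∀ i, vertexElt k Q i ∈ S) (ha : ∀ i j, arrowElt Q τ i j ∈ S) (x : Preproj k Q) :
    x ∈ S := by
  classical
  have hg : ∀ y, gen k Q y ∈ S := by
    rintro (i | α | α)
    · exact hv i
    · have := ha α.1.2 α.1.1
      rwa [arrowElt_of_adj α.2] at this
    · have := S.smul_mem (ha α.1.1 α.1.2) (τ α.1.2 α.1.1)
      rwa [arrowElt_of_adj' hQ α.2, smul_smul,
        mul_inv_cancel₀ (hne _ _ ((hadj _ _).2 (Or.inr α.2))), one_smul] at this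
  obtain ⟨y, rfl⟩ := RingQuot.mkAlgHom_surjective k (PreprojRel k Q) x
  induction y with
  | grade0 r => rw [AlgHom.commutes]; exact S.algebraMap_mem r
  | grade1 y => exact hg y
  | mul y z hy hz => rw [_root_.map_mul]; exact S.mul_mem hy hz
  | add y z hy hz => rw [map_add]; exact S.add_mem hy hz

end Preproj

/-! ### Generators and relations for the skew group algebra -/

/-- A preprojective family together with a compatible representation of a group that acts on the
vertices. -/
structure IsSkewFamily {k : Type*} [Field k] {V : Type*} [Fintype V] {Γ : Type*} [Group Γ]
    [MulAction Γ V] (adj : V → V → Prop) (τ : V → V → k) {R : Type*} [Semiring R] [Algebra k R]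
    (e : V → R) (a : V → V → R) (g : Γ →* R) : Prop extends IsPreprojFamily adj τ e a where
  smul_vertex : ∀ γ i, g γ * e i = e (γ • i) * g γ
  smul_arrow : ∀ γ i j, g γ * a i j = a (γ • i) (γ • j) * g γ

namespace CompatibleOrientation

variable {k : Type u} [Field k] {I : Type v} {Δ : SimpleGraph I} {a : Δ ≃g Δ}
  (Q : CompatibleOrientation Δ a) {τ : I → I → k}

lemma adj_smul (γ : Subgroup.zpowers a) (i j : I) :
    Q.Adj (γ • i) (γ • j) ↔ Q.Adj i j :=
  Q.zpowers_le_stabilizer γ.2 i j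

open Classical in
variable (k) in
/-- The signs of the orientation. -/
noncomputable def sign (i j : I) : k :=
  if Q.Adj j i then 1 else if Q.Adj i j then -1 else 0

lemma sign_antisymm (i j : I) : Q.sign k i j = - Q.sign k j i := by
  unfold sign
  have := Q.asymm i j
  split_ifs <;> simp_all

lemma sign_ne_zero (i j : I) (h : Δ.Adj i j) : Q.sign k i j ≠ 0 := by
  unfold sign
  rw [Q.adj_iff] at h
  split_ifs <;> simp_all

lemma sign_smul (γ : Subgroup.zpowers a) (i j : I) :
    Q.sign k (γ • i) (γ • j) = Q.sign k i j := by
  classical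
  unfold sign
  have h1 := Q.adj_smul γ i j
  have h2 := Q.adj_smul γ j i
  split_ifs <;> simp_all

variable [Fintype I]

lemma smul_gen (γ : Subgroup.zpowers a) (x : PreprojGen Q.toDigraph) :
    γ • Preproj.gen k Q.toDigraph x =
      Preproj.gen k Q.toDigraph (Preproj.mapGen (Q.quiverAut γ) x) := by
  rw [smul_def, Preproj.map_gen]

lemma smul_vertexElt (γ : Subgroup.zpowers a) (i : I) :
    γ • Preproj.vertexElt k Q.toDigraph i = Preproj.vertexElt k Q.toDigraph (γ • i) :=
  Q.smul_gen γ _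

lemma smul_arrowElt (hτ : ∀ (γ : Subgroup.zpowers a) i j, τ (γ • i) (γ • j) = τ i j)
    (γ : Subgroup.zpowers a) (i j : I) :
    γ • Preproj.arrowElt Q.toDigraph τ i j = Preproj.arrowElt Q.toDigraph τ (γ • i) (γ • j) := by
  classical
  unfold Preproj.arrowElt
  simp only [adj_smul, hτ]
  split_ifs
  · exact Q.smul_gen γ _
  · rw [smul_comm]; congr 1; exact Q.smul_gen γ _
  · simp

variable (k) in
/-- The idempotents of the skew group algebra. -/
noncomputable def skewVertex (i : I) : Q.skewGroupAlgebra k :=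
  .single 1 (Preproj.vertexElt k Q.toDigraph i)

/-- The arrows of the skew group algebra. -/
noncomputable def skewArrow (τ : I → I → k) (i j : I) : Q.skewGroupAlgebra k :=
  .single 1 (Preproj.arrowElt Q.toDigraph τ i j)

variable (k) in
/-- The inclusion of the preprojective algebra into the skew group algebra. -/
noncomputable def inclSkew : Q.preprojectiveAlgebra k →ₐ[k] Q.skewGroupAlgebra k where
  __ := SkewMonoidAlgebra.singleOneRingHom
  commutes' _ := rfl

lemma inclSkew_apply (x : Q.preprojectiveAlgebra k) : Q.inclSkew k x = .single 1 x := rfl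

/-- The tautological skew family in the skew group algebra. -/
lemma isSkewFamily (hanti : ∀ i j, τ i j = - τ j i) (hne : ∀ i j, Δ.Adj i j → τ i j ≠ 0)
    (hτ : ∀ (γ : Subgroup.zpowers a) i j, τ (γ • i) (γ • j) = τ i j) :
    IsSkewFamily Δ.Adj τ (Q.skewVertex k) (Q.skewArrow τ) (SkewMonoidAlgebra.of _ _) where
  toIsPreprojFamily := by
    have h := (Preproj.isPreprojFamily Q.asymm Q.adj_iff hanti hne).map (Q.inclSkew k)
    exact h
  smul_vertex γ i := by
    rw [skewVertex, skewVertex, SkewMonoidAlgebra.of_apply, SkewMonoidAlgebra.single_mul_single,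
      SkewMonoidAlgebra.single_mul_single, ← Q.smul_vertexElt]
    simp
  smul_arrow γ i j := by
    rw [skewArrow, skewArrow, SkewMonoidAlgebra.of_apply, SkewMonoidAlgebra.single_mul_single,
      SkewMonoidAlgebra.single_mul_single, ← Q.smul_arrowElt hτ]
    simp

variable {R : Type*} [Semiring R] [Algebra k R] {e : I → R} {b : I → I → R}
  {g : Subgroup.zpowers a →* R}

/-- A skew family gives a homomorphism from the skew group algebra. -/
noncomputable def ofSkewFamily (hanti : ∀ i j, τ i j = - τ j i)
    (hne : ∀ i j, Δ.Adj i j → τ i j ≠ 0)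
    (hτ : ∀ (γ : Subgroup.zpowers a) i j, τ (γ • i) (γ • j) = τ i j)
    (h : IsSkewFamily Δ.Adj τ e b g) : Q.skewGroupAlgebra k →ₐ[k] R :=
  SkewMonoidAlgebra.liftNCAlgHom
    (Preproj.ofFamily Q.asymm Q.adj_iff hanti h.toIsPreprojFamily) g (by
      intro x γ
      let F := Preproj.ofFamily Q.asymm Q.adj_iff hanti h.toIsPreprojFamily
      have hinv : g γ⁻¹ * g γ = 1 := by rw [← _root_.map_mul, inv_mul_cancel, _root_.map_one]
      -- For fixed γ, the elements that satisfy the commutation rule form a subalgebra, so the rule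
      -- need only be tested on generators.
      let S : Subalgebra k (Q.preprojectiveAlgebra k) :=
        { carrier := {x | F (γ • x) * g γ = g γ * F x}
          mul_mem' := fun {x y} hx hy => by
            change F (γ • (x * y)) * g γ = g γ * F (x * y)
            rw [smul_mul', _root_.map_mul, mul_assoc, hy, ← mul_assoc, hx, _root_.map_mul,
              mul_assoc]
          add_mem' := fun {x y} hx hy => by
            change F (γ • (x + y)) * g γ = g γ * F (x + y)
            rw [smul_add, _root_.map_add, add_mul, hx, hy, _root_.map_add, mul_add]
          algebraMap_mem' := fun r => by
            change F (γ • algebraMap _ _ r) * g γ = g γ * F (algebraMap _ _ r)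
            rw [smul_algebraMap, AlgHom.commutes, Algebra.commutes] }
      refine Preproj.adjoin_eq_top (S := S) (τ := τ) Q.asymm Q.adj_iff hne (fun i => ?_)
        (fun i j => ?_) x
      · change F (γ • _) * g γ = g γ * F _
        rw [Q.smul_vertexElt, Preproj.ofFamily_vertexElt, Preproj.ofFamily_vertexElt, h.smul_vertex]
      · change F (γ • _) * g γ = g γ * F _
        rw [Q.smul_arrowElt hτ, Preproj.ofFamily_arrowElt _ _ _ hne,
          Preproj.ofFamily_arrowElt _ _ _ hne, h.smul_arrow])

lemma ofSkewFamily_single (hanti : ∀ i j, τ i j = - τ j i)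
    (hne : ∀ i j, Δ.Adj i j → τ i j ≠ 0)
    (hτ : ∀ (γ : Subgroup.zpowers a) i j, τ (γ • i) (γ • j) = τ i j)
    (h : IsSkewFamily Δ.Adj τ e b g) (γ : Subgroup.zpowers a) (x : Q.preprojectiveAlgebra k) :
    Q.ofSkewFamily hanti hne hτ h (.single γ x) =
      Preproj.ofFamily Q.asymm Q.adj_iff hanti h.toIsPreprojFamily x * g γ :=
  SkewMonoidAlgebra.liftNC_single _ _ _ _

lemma ofSkewFamily_vertex (hanti : ∀ i j, τ i j = - τ j i)
    (hne : ∀ i j, Δ.Adj i j → τ i j ≠ 0)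
    (hτ : ∀ (γ : Subgroup.zpowers a) i j, τ (γ • i) (γ • j) = τ i j)
    (h : IsSkewFamily Δ.Adj τ e b g) (i : I) :
    Q.ofSkewFamily hanti hne hτ h (Q.skewVertex k i) = e i := by
  rw [skewVertex, ofSkewFamily_single, Preproj.ofFamily_vertexElt, _root_.map_one, mul_one]

lemma ofSkewFamily_arrow (hanti : ∀ i j, τ i j = - τ j i)
    (hne : ∀ i j, Δ.Adj i j → τ i j ≠ 0)
    (hτ : ∀ (γ : Subgroup.zpowers a) i j, τ (γ • i) (γ • j) = τ i j)
    (h : IsSkewFamily Δ.Adj τ e b g) (i j : I) :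
    Q.ofSkewFamily hanti hne hτ h (Q.skewArrow τ i j) = b i j := by
  rw [skewArrow, ofSkewFamily_single, Preproj.ofFamily_arrowElt _ _ _ hne, _root_.map_one, mul_one]

lemma ofSkewFamily_of (hanti : ∀ i j, τ i j = - τ j i)
    (hne : ∀ i j, Δ.Adj i j → τ i j ≠ 0)
    (hτ : ∀ (γ : Subgroup.zpowers a) i j, τ (γ • i) (γ • j) = τ i j)
    (h : IsSkewFamily Δ.Adj τ e b g) (γ : Subgroup.zpowers a) :
    Q.ofSkewFamily hanti hne hτ h (SkewMonoidAlgebra.of _ _ γ) = g γ := by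
  rw [SkewMonoidAlgebra.of_apply, ofSkewFamily_single, _root_.map_one, one_mul]

/-- The skew group algebra is generated by the idempotents, the arrows and the group. -/
lemma mem_of_skew_generators (hne : ∀ i j, Δ.Adj i j → τ i j ≠ 0)
    {S : Subalgebra k (Q.skewGroupAlgebra k)}
    (hv : ∀ i, Q.skewVertex k i ∈ S) (ha : ∀ i j, Q.skewArrow τ i j ∈ S)
    (hg : ∀ γ, SkewMonoidAlgebra.of _ _ γ ∈ S) (x : Q.skewGroupAlgebra k) : x ∈ S := by
  have h1 : ∀ y, Q.inclSkew k y ∈ S := fun y =>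
    Preproj.adjoin_eq_top (S := S.comap (Q.inclSkew k)) (τ := τ) Q.asymm Q.adj_iff hne hv ha y
  induction x using SkewMonoidAlgebra.induction_on with
  | zero => exact S.zero_mem
  | single γ y =>
    have := S.mul_mem (h1 y) (hg γ)
    rwa [inclSkew_apply, SkewMonoidAlgebra.of_apply, SkewMonoidAlgebra.single_mul_single,
      smul_one, mul_one, one_mul] at this
  | add x y hx hy => exact S.add_mem hx hy

end CompatibleOrientation

/-! ### Corner rings as algebras -/

namespace IsIdempotentElem

variable {k : Type*} [Field k] {A : Type*} [Ring A] [Algebra k A] {ε : A}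

lemma corner_left (hε : IsIdempotentElem ε) (r : hε.Corner) : ε * r.1 = r.1 :=
  ((Subsemigroup.mem_corner_iff hε).1 r.2).1

lemma corner_right (hε : IsIdempotentElem ε) (r : hε.Corner) : r.1 * ε = r.1 :=
  ((Subsemigroup.mem_corner_iff hε).1 r.2).2

/-- An element of the corner ring. -/
def toCorner (hε : IsIdempotentElem ε) (r : A) (h1 : ε * r = r) (h2 : r * ε = r) : hε.Corner :=
  ⟨r, (Subsemigroup.mem_corner_iff hε).2 ⟨h1, h2⟩⟩

noncomputable instance cornerAlgebra (hε : IsIdempotentElem ε) : Algebra k hε.Corner where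
  smul c r := hε.toCorner (c • r.1) (by rw [mul_smul_comm, hε.corner_left])
    (by rw [smul_mul_assoc, hε.corner_right])
  algebraMap :=
    { toFun := fun c => hε.toCorner (c • ε) (by rw [mul_smul_comm, hε.eq])
        (by rw [smul_mul_assoc, hε.eq])
      map_one' := Subtype.ext (one_smul k ε)
      map_mul' := fun c d => Subtype.ext (by
        change (c * d) • ε = (c • ε) * (d • ε)
        rw [smul_mul_smul_comm, hε.eq])
      map_zero' := Subtype.ext (zero_smul k ε)
      map_add' := fun c d => Subtype.ext (add_smul c d ε) }
  commutes' c r := Subtype.ext (by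
    change (c • ε) * r.1 = r.1 * (c • ε)
    rw [smul_mul_assoc, hε.corner_left, mul_smul_comm, hε.corner_right])
  smul_def' c r := Subtype.ext (by
    change c • r.1 = (c • ε) * r.1
    rw [smul_mul_assoc, hε.corner_left])

variable (k) in
/-- The inclusion of the corner ring. -/
def cornerVal (hε : IsIdempotentElem ε) : hε.Corner →ₗ[k] A where
  toFun r := r.1
  map_add' _ _ := rfl
  map_smul' _ _ := rfl

@[simp] lemma cornerVal_mul (hε : IsIdempotentElem ε) (r s : hε.Corner) :
    hε.cornerVal k (r * s) = hε.cornerVal k r * hε.cornerVal k s := rfl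

@[simp] lemma cornerVal_one (hε : IsIdempotentElem ε) : hε.cornerVal k 1 = ε := rfl

@[simp] lemma cornerVal_toCorner (hε : IsIdempotentElem ε) (r : A) (h1 : ε * r = r)
    (h2 : r * ε = r) : hε.cornerVal k (hε.toCorner r h1 h2) = r := rfl

lemma cornerVal_injective (hε : IsIdempotentElem ε) : Function.Injective (hε.cornerVal k) :=
  fun _ _ h => Subtype.ext h

lemma mul_cornerVal (hε : IsIdempotentElem ε) (r : hε.Corner) :
    ε * hε.cornerVal k r = hε.cornerVal k r := hε.corner_left r

end IsIdempotentElem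

/-! ### Orbit dualities and sums over stabilizers -/

/-- Two graphs, with vertex sets `V` and `W` fibered over the same set `I`, are in duality with
respect to a group `Γ` that acts on the first one: the fiber of `W` over `i` is the set of
characters of the stabilizer of the base point `x i` of `V`, and two of these characters are
adjacent if they agree on the common stabilizer. -/
structure OrbitDuality (k : Type*) [Field k] (Γ : Type*) [Group Γ] [Finite Γ] {V W : Type*}
    [Fintype W] [MulAction Γ V] (I : Type*) (adjV : V → V → Prop) (adjW : W → W → Prop) where
  R : I → I → Prop
  π : V → I
  x : I → V
  ρ : W → I
  χ : W → Γ →* kˣ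
  π_x : ∀ i, π (x i) = i
  π_smul : ∀ (γ : Γ) v, π (γ • v) = π v
  exists_smul : ∀ v, ∃ γ : Γ, γ • x (π v) = v
  adjV_iff : ∀ v w, adjV v w ↔
    R (π v) (π w) ∧ ∃ γ : Γ, γ • x (π v) = v ∧ γ • x (π w) = w
  adjW_iff : ∀ z w, adjW z w ↔ R (ρ z) (ρ w) ∧
    ∀ h : Γ, h • x (ρ z) = x (ρ z) → h • x (ρ w) = x (ρ w) → χ z h = χ w h
  orthogonality : ∀ z w, ρ z = ρ w → z ≠ w →
    ∃ h : Γ, h • x (ρ z) = x (ρ z) ∧ χ z h ≠ χ w h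
  sum_character : ∀ i (h : Γ), h • x i = x i → h ≠ 1 →
    ∑ᶠ z ∈ {z | ρ z = i}, ((χ z h : kˣ) : k) = 0
  card_fiber : ∀ i, Nat.card {z // ρ z = i} = Nat.card (MulAction.stabilizer Γ (x i))
  card_ne : (Nat.card Γ : k) ≠ 0

namespace OrbitDuality

variable {k : Type*} [Field k] {Γ : Type*} [Group Γ] [Fintype Γ] {V W : Type*}
  [Fintype W] [MulAction Γ V] {I : Type*} {adjV : V → V → Prop}
  {adjW : W → W → Prop} (D : OrbitDuality k Γ I adjV adjW)

open Classical in
/-- The stabilizer of the base point over `i`. -/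
noncomputable def stab (i : I) : Finset Γ := Finset.univ.filter fun h => h • D.x i = D.x i

open Classical in
/-- The common stabilizer of the base points over `i` and `j`. -/
noncomputable def stab₂ (i j : I) : Finset Γ :=
  Finset.univ.filter fun h => h • D.x i = D.x i ∧ h • D.x j = D.x j

open Classical in
/-- The fiber of `W` over `i`. -/
noncomputable def fiber (i : I) : Finset W := Finset.univ.filter fun z => D.ρ z = i

lemma mem_stab {i : I} {h : Γ} : h ∈ D.stab i ↔ h • D.x i = D.x i := by
  classical simp [stab]

lemma mem_stab₂ {i j : I} {h : Γ} :
    h ∈ D.stab₂ i j ↔ h • D.x i = D.x i ∧ h • D.x j = D.x j := by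
  classical simp [stab₂]

lemma mem_fiber {i : I} {z : W} : z ∈ D.fiber i ↔ D.ρ z = i := by
  classical simp [fiber]

lemma one_mem_stab (i : I) : (1 : Γ) ∈ D.stab i := by simp [mem_stab]

lemma mul_mem_stab {i : I} {g h : Γ} (hg : g ∈ D.stab i) (hh : h ∈ D.stab i) :
    g * h ∈ D.stab i := by
  rw [mem_stab] at *; rw [mul_smul, hh, hg]

lemma inv_mem_stab {i : I} {h : Γ} : h⁻¹ ∈ D.stab i ↔ h ∈ D.stab i := by
  simp only [mem_stab]; rw [inv_smul_eq_iff, eq_comm]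

lemma stab₂_comm (i j : I) : D.stab₂ i j = D.stab₂ j i := by
  ext h; simp only [mem_stab₂, and_comm]

lemma card_stab (i : I) : (D.stab i).card = Nat.card (MulAction.stabilizer Γ (D.x i)) := by
  classical
  rw [Nat.card_eq_fintype_card, Fintype.card_subtype]
  congr 1

lemma card_stab_ne (i : I) : ((D.stab i).card : k) ≠ 0 := by
  intro h
  obtain ⟨c, hc⟩ := (MulAction.stabilizer Γ (D.x i)).card_subgroup_dvd_card
  apply D.card_ne
  rw [hc, Nat.cast_mul, ← D.card_stab, h, zero_mul]

lemma card_stab₂_ne (i j : I) : ((D.stab₂ i j).card : k) ≠ 0 := by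
  classical
  have h0 : (D.stab₂ i j).card =
      Nat.card (MulAction.stabilizer Γ (D.x i) ⊓ MulAction.stabilizer Γ (D.x j) : Subgroup Γ) := by
    rw [Nat.card_eq_fintype_card, Fintype.card_subtype]
    congr 1
    ext h
    simp [mem_stab₂, Subgroup.mem_inf]
  intro h
  obtain ⟨c, hc⟩ := (MulAction.stabilizer Γ (D.x i) ⊓
    MulAction.stabilizer Γ (D.x j)).card_subgroup_dvd_card
  apply D.card_ne
  rw [hc, Nat.cast_mul, ← h0, h, zero_mul]

lemma card_fiber_eq (i : I) : (D.fiber i).card = (D.stab i).card := by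
  classical
  rw [D.card_stab, ← D.card_fiber, Nat.card_eq_fintype_card, Fintype.card_subtype]
  rfl

lemma sum_stab_mul_left {M : Type*} [AddCommMonoid M] {i : I} {g : Γ} (hg : g ∈ D.stab i)
    (F : Γ → M) : ∑ h ∈ D.stab i, F (g * h) = ∑ h ∈ D.stab i, F h :=
  Finset.sum_equiv (Equiv.mulLeft g)
    (fun h => ⟨fun hh => D.mul_mem_stab hg hh, fun hh => by
      simpa using D.mul_mem_stab (D.inv_mem_stab.2 hg) hh⟩) (fun _ _ => rfl)

lemma sum_stab_mul_right {M : Type*} [AddCommMonoid M] {i : I} {g : Γ} (hg : g ∈ D.stab i)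
    (F : Γ → M) : ∑ h ∈ D.stab i, F (h * g) = ∑ h ∈ D.stab i, F h :=
  Finset.sum_equiv (Equiv.mulRight g)
    (fun h => ⟨fun hh => D.mul_mem_stab hh hg, fun hh => by
      simpa using D.mul_mem_stab hh (D.inv_mem_stab.2 hg)⟩) (fun _ _ => rfl)

/-- Orthogonality of characters. -/
lemma sum_stab_character [DecidableEq W] {z w : W} (hzw : D.ρ z = D.ρ w) :
    ∑ h ∈ D.stab (D.ρ z), ((D.χ z h⁻¹ * D.χ w h : kˣ) : k) =
      if z = w then ((D.stab (D.ρ z)).card : k) else 0 := by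
  split_ifs with h
  · subst h
    simp
  · obtain ⟨g, hg, hne⟩ := D.orthogonality z w hzw h
    -- Translation by `g` multiplies the sum by the value at `g` of the quotient character, which is
    -- not 1; so the sum vanishes.
    have h1 := D.sum_stab_mul_left (D.mem_stab.2 hg)
      (fun h => ((D.χ z h⁻¹ * D.χ w h : kˣ) : k))
    have h2 : ∀ h, ((D.χ z (g * h)⁻¹ * D.χ w (g * h) : kˣ) : k) =
        ((D.χ z g)⁻¹ * D.χ w g : kˣ) * ((D.χ z h⁻¹ * D.χ w h : kˣ) : k) := by
      intro h
      rw [← Units.val_mul]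
      congr 1
      simp only [mul_inv_rev, map_mul, map_inv]
      rw [mul_mul_mul_comm, mul_comm (D.χ z h)⁻¹, mul_mul_mul_comm, mul_comm (D.χ w g)]
    simp only [h2] at h1
    rw [← Finset.mul_sum] at h1
    by_contra h3
    have h4 := mul_right_cancel₀ h3 (h1.trans (one_mul _).symm)
    exact hne (inv_mul_eq_one.1 (Units.ext h4))

lemma sum_fiber_character [DecidableEq Γ] {i : I} {h : Γ} (hh : h ∈ D.stab i) :
    ∑ z ∈ D.fiber i, ((D.χ z h : kˣ) : k) = if h = 1 then ((D.stab i).card : k) else 0 := by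
  split_ifs with h1
  · subst h1
    simp [card_fiber_eq]
  · rw [← D.sum_character i h (D.mem_stab.1 hh) h1]
    exact (finsum_mem_eq_sum_of_inter_support_eq _ (by ext z; simp [mem_fiber])).symm

variable [Fintype V] [Fintype I]

/-- A sum over the neighbours of a vertex, as a sum over the base points. -/
lemma sum_neighbours {M : Type*} [AddCommGroup M] [Module k M] (F : V → M) (γ : Γ) (i : I)
    (hF : ∀ w, ¬ adjV (γ • D.x i) w → F w = 0) :
    ∑ w, F w = ∑ j, ((D.stab₂ i j).card : k)⁻¹ • ∑ h ∈ D.stab i, F (γ • h • D.x j) := by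
  classical
  have h1 : ∀ j, ∑ h ∈ D.stab i, F (γ • h • D.x j) =
      ∑ w, (((D.stab i).filter fun h => γ • h • D.x j = w).card : k) • F w := by
    intro j
    rw [← Finset.sum_fiberwise (s := D.stab i) (g := fun h => γ • h • D.x j)]
    refine Finset.sum_congr rfl fun w _ => ?_
    rw [Finset.sum_congr rfl (g := fun _ => F w) (fun h hh => by rw [(Finset.mem_filter.1 hh).2]),
      Finset.sum_const, Nat.cast_smul_eq_nsmul]
  simp only [h1, Finset.smul_sum]
  rw [Finset.sum_comm]
  refine Finset.sum_congr rfl fun w _ => ?_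
  by_cases hw : adjV (γ • D.x i) w
  · rw [Finset.sum_eq_single (D.π w)]
    · rw [D.adjV_iff, D.π_smul, D.π_x] at hw
      obtain ⟨-, δ, hδ, hδ'⟩ := hw
      -- The elements `h` that hit a given neighbour `w` form a coset of the common stabilizer,
      -- where δ carries the base edge to the given edge.
      have h2 : ((D.stab i).filter fun h => γ • h • D.x (D.π w) = w).card =
          (D.stab₂ i (D.π w)).card := by
        symm
        refine Finset.card_equiv (Equiv.mulLeft (γ⁻¹ * δ)) fun h => ?_
        simp only [mem_stab₂, Finset.mem_filter, mem_stab, Equiv.coe_mulLeft]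
        constructor
        · rintro ⟨h1, h2⟩
          refine ⟨?_, ?_⟩
          · rw [mul_smul, h1, mul_smul, hδ, inv_smul_smul]
          · rw [← mul_smul, ← mul_assoc, mul_inv_cancel_left, mul_smul, h2, hδ']
        · rintro ⟨h1, h2⟩
          constructor
          · rw [mul_smul, mul_smul, inv_smul_eq_iff, ← hδ] at h1
            exact smul_left_cancel _ h1
          · rw [← mul_smul, ← mul_assoc, mul_inv_cancel_left, mul_smul] at h2
            conv_rhs at h2 => rw [← hδ']
            exact smul_left_cancel _ h2
      rw [h2, smul_smul, inv_mul_cancel₀ (D.card_stab₂_ne _ _), one_smul]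
    · intro j _ hj
      rw [Finset.filter_false_of_mem, Finset.card_empty, Nat.cast_zero, zero_smul, smul_zero]
      rintro h - rfl
      apply hj
      rw [D.π_smul, D.π_smul, D.π_x]
    · simp
  · simp [hF w hw]

end OrbitDuality

/-! ### Character idempotents and the dual family in the corner ring -/

namespace OrbitDuality

variable {k : Type*} [Field k] {Γ : Type*} [Group Γ] [Fintype Γ] {V W : Type*}
  [Fintype W] [MulAction Γ V] {I : Type*} {adjV : V → V → Prop}
  {adjW : W → W → Prop} (D : OrbitDuality k Γ I adjV adjW)
  {τ : V → V → k} {A : Type*} [Ring A] [Algebra k A] {e : V → A} {a : V → V → A} {g : Γ →* A}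

/-- The weights of the second graph. -/
noncomputable def dualWeight (τ : V → V → k) (z w : W) : k :=
  τ (D.x (D.ρ z)) (D.x (D.ρ w)) * ((D.stab₂ (D.ρ z) (D.ρ w)).card : k)⁻¹

lemma dualWeight_antisymm (hτ : ∀ i j, τ i j = - τ j i) (z w : W) :
    D.dualWeight τ z w = - D.dualWeight τ w z := by
  rw [dualWeight, dualWeight, hτ, D.stab₂_comm, neg_mul]

lemma adj_x {i j : I} : adjV (D.x i) (D.x j) ↔ D.R i j := by
  rw [D.adjV_iff, D.π_x, D.π_x]
  exact ⟨fun h => h.1, fun h => ⟨h, 1, by simp⟩⟩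

lemma dualWeight_ne_zero (hτ : ∀ i j, adjV i j → τ i j ≠ 0) (z w : W) (h : adjW z w) :
    D.dualWeight τ z w ≠ 0 :=
  mul_ne_zero (hτ _ _ (D.adj_x.2 ((D.adjW_iff _ _).1 h).1)) (inv_ne_zero (D.card_stab₂_ne _ _))

/-- The idempotent attached to a character of the stabilizer of a base point. -/
noncomputable def charIdem (e : V → A) (g : Γ →* A) (z : W) : A :=
  ((D.stab (D.ρ z)).card : k)⁻¹ •
    ∑ h ∈ D.stab (D.ρ z), ((D.χ z h⁻¹ : kˣ) : k) • (g h * e (D.x (D.ρ z)))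

/-- The sum of the idempotents of the base points. -/
noncomputable def baseIdem [Fintype I] (e : V → A) : A := ∑ i, e (D.x i)

lemma x_injective : Function.Injective D.x := fun i j h => by
  rw [← D.π_x i, h, D.π_x]

lemma g_mul_charIdem {z : W} {h : Γ} (hh : h ∈ D.stab (D.ρ z)) :
    g h * D.charIdem e g z = ((D.χ z h : kˣ) : k) • D.charIdem e g z := by
  rw [charIdem, mul_smul_comm, smul_comm, Finset.mul_sum]
  congr 1
  rw [← D.sum_stab_mul_left hh (fun l => ((D.χ z l⁻¹ : kˣ) : k) • (g l * e (D.x (D.ρ z)))),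
    Finset.smul_sum]
  refine Finset.sum_congr rfl fun l _ => ?_
  rw [smul_smul, ← Units.val_mul, mul_inv_rev, map_mul (D.χ z), mul_comm, mul_assoc, ← map_mul,
    inv_mul_cancel, map_one, mul_one, mul_smul_comm, map_mul, mul_assoc]

/-- Summing over all characters of the stabilizer kills every term except the one for the neutral
element. -/
lemma sum_fiber_charIdem (i : I) : ∑ z ∈ D.fiber i, D.charIdem e g z = e (D.x i) := by
  classical
  have h1 : ∀ z ∈ D.fiber i, D.charIdem e g z = ((D.stab i).card : k)⁻¹ •
      ∑ h ∈ D.stab i, ((D.χ z h⁻¹ : kˣ) : k) • (g h * e (D.x i)) := by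
    intro z hz
    rw [charIdem, D.mem_fiber.1 hz]
  rw [Finset.sum_congr rfl h1, ← Finset.smul_sum, Finset.sum_comm]
  simp only [← Finset.sum_smul]
  rw [Finset.sum_congr rfl (g := fun h =>
    (if h = 1 then ((D.stab i).card : k) else 0) • (g h * e (D.x i)))]
  · simp [ite_smul, D.one_mem_stab, smul_smul, inv_mul_cancel₀ (D.card_stab_ne i)]
  · intro h hh
    rw [D.sum_fiber_character (D.inv_mem_stab.2 hh)]
    simp

lemma sum_charIdem [Fintype I] : ∑ z, D.charIdem e g z = D.baseIdem e := by
  classical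
  rw [baseIdem, ← Finset.sum_fiberwise (g := D.ρ)]
  refine Finset.sum_congr rfl fun i _ => ?_
  rw [← D.sum_fiber_charIdem (e := e) (g := g) i]
  rfl

section

variable [Fintype V] (S : IsSkewFamily adjV τ e a g)
include S

lemma g_mul_e {i : I} {h : Γ} (hh : h ∈ D.stab i) : g h * e (D.x i) = e (D.x i) * g h := by
  rw [S.smul_vertex, D.mem_stab.1 hh]

lemma charIdem_mul_g {z : W} {h : Γ} (hh : h ∈ D.stab (D.ρ z)) :
    D.charIdem e g z * g h = ((D.χ z h : kˣ) : k) • D.charIdem e g z := by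
  rw [charIdem, smul_mul_assoc, smul_comm, Finset.sum_mul]
  congr 1
  rw [← D.sum_stab_mul_right hh (fun l => ((D.χ z l⁻¹ : kˣ) : k) • (g l * e (D.x (D.ρ z)))),
    Finset.smul_sum]
  refine Finset.sum_congr rfl fun l _ => ?_
  rw [smul_smul, ← Units.val_mul, mul_inv_rev, map_mul (D.χ z), ← mul_assoc, ← map_mul,
    mul_inv_cancel, map_one, one_mul, smul_mul_assoc, map_mul, mul_assoc, mul_assoc,
    D.g_mul_e S hh]

lemma charIdem_mul_e (z : W) :
    D.charIdem e g z * e (D.x (D.ρ z)) = D.charIdem e g z := by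
  rw [charIdem, smul_mul_assoc, Finset.sum_mul]
  congr 1
  refine Finset.sum_congr rfl fun l _ => ?_
  rw [smul_mul_assoc, mul_assoc, S.mul_self]

lemma e_mul_charIdem (z : W) :
    e (D.x (D.ρ z)) * D.charIdem e g z = D.charIdem e g z := by
  rw [charIdem, mul_smul_comm, Finset.mul_sum]
  congr 1
  refine Finset.sum_congr rfl fun l hl => ?_
  rw [mul_smul_comm, ← mul_assoc, ← D.g_mul_e S hl, mul_assoc, S.mul_self]

/-- Over one base point this is orthogonality of characters; over different base points the vertex
idempotents are already orthogonal. -/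
lemma charIdem_mul_charIdem [DecidableEq W] (z w : W) :
    D.charIdem e g z * D.charIdem e g w = if z = w then D.charIdem e g z else 0 := by
  by_cases hzw : D.ρ z = D.ρ w
  · have h1 : D.charIdem e g z * D.charIdem e g w =
        ((D.stab (D.ρ z)).card : k)⁻¹ • (∑ h ∈ D.stab (D.ρ z),
          ((D.χ z h⁻¹ * D.χ w h : kˣ) : k)) • D.charIdem e g w := by
      conv_lhs => rw [charIdem]
      rw [smul_mul_assoc, Finset.sum_mul, Finset.sum_smul]
      congr 1
      refine Finset.sum_congr rfl fun h hh => ?_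
      rw [smul_mul_assoc, mul_assoc, hzw, D.e_mul_charIdem S, D.g_mul_charIdem (hzw ▸ hh),
        smul_smul, Units.val_mul]
    rw [h1, D.sum_stab_character hzw]
    split_ifs with h
    · rw [smul_smul, inv_mul_cancel₀ (D.card_stab_ne _), one_smul, h]
    · rw [zero_smul, smul_zero]
  · rw [if_neg (fun h => hzw (congrArg _ h)), ← D.charIdem_mul_e S, ← D.e_mul_charIdem S w,
      mul_assoc, ← mul_assoc (e _), S.mul_of_ne _ _ (fun h => hzw (D.x_injective h)), zero_mul,
      mul_zero]

/-- If the characters differ at some `h` fixing both base points, then `h` commutes with the arrow,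
and absorbing it on the left or on the right produces two different scalars. -/
lemma charIdem_mul_arrow_mul_eq_zero {z w : W} (h : ¬ adjW z w) :
    D.charIdem e g z * a (D.x (D.ρ z)) (D.x (D.ρ w)) * D.charIdem e g w = 0 := by
  by_cases hR : D.R (D.ρ z) (D.ρ w)
  · rw [D.adjW_iff] at h
    push Not at h
    obtain ⟨h, hz, hw, hne⟩ := h hR
    have h1 : D.charIdem e g z * a (D.x (D.ρ z)) (D.x (D.ρ w)) * g h * D.charIdem e g w =
        D.charIdem e g z * g h * a (D.x (D.ρ z)) (D.x (D.ρ w)) * D.charIdem e g w := by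
      rw [mul_assoc (D.charIdem e g z) (g h), S.smul_arrow, hz, hw, mul_assoc (D.charIdem e g z)]
    rw [D.charIdem_mul_g S (D.mem_stab.2 hz), mul_assoc _ (g h),
      D.g_mul_charIdem (D.mem_stab.2 hw), mul_smul_comm, smul_mul_assoc, smul_mul_assoc,
      ← sub_eq_zero, ← sub_smul, smul_eq_zero, sub_eq_zero] at h1
    exact h1.resolve_left fun h2 => hne (Units.ext h2.symm)
  · rw [S.eq_zero _ _ (fun h2 => hR (D.adj_x.1 h2)), mul_zero, zero_mul]

/-- This is the relation at the base point, compressed by the character idempotent. The neighbours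
over `j` are translates of `D.x j` by the stabilizer of `D.x i`. All translates contribute equally,
since the idempotent absorbs `h` on both sides with scalars that cancel. Counting each neighbour
once introduces the inverse order of the common stabilizer. -/
lemma charIdem_rel [Fintype I] (hτ : ∀ (γ : Γ) v w, τ (γ • v) (γ • w) = τ v w) (z : W) :
    ∑ j, (τ (D.x (D.ρ z)) (D.x j) * ((D.stab₂ (D.ρ z) j).card : k)⁻¹) •
      (D.charIdem e g z * a (D.x (D.ρ z)) (D.x j) * (a (D.x j) (D.x (D.ρ z)) *
        D.charIdem e g z)) = 0 := by
  set i := D.ρ z with hi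
  have h1 := D.sum_neighbours
    (fun w => D.charIdem e g z * (τ (D.x i) w • (a (D.x i) w * a w (D.x i))) *
      D.charIdem e g z) 1 i (fun w hw => by
        rw [one_smul] at hw
        rw [S.eq_zero _ _ hw, zero_mul, smul_zero, mul_zero, zero_mul])
  rw [← Finset.sum_mul, ← Finset.mul_sum, S.rel, mul_zero, zero_mul] at h1
  have h2 : ∀ j, ∀ h ∈ D.stab i, D.charIdem e g z * (τ (D.x i) ((1 : Γ) • h • D.x j) •
      (a (D.x i) ((1 : Γ) • h • D.x j) * a ((1 : Γ) • h • D.x j) (D.x i))) * D.charIdem e g z =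
      τ (D.x i) (D.x j) • (D.charIdem e g z * a (D.x i) (D.x j) * (a (D.x j) (D.x i) *
        D.charIdem e g z)) := by
    intro j h hh
    have hi' := D.mem_stab.1 hh
    have ha : g h * a (D.x i) (D.x j) = a (D.x i) (h • D.x j) * g h := by
      rw [S.smul_arrow, hi']
    have ha' : g h * a (D.x j) (D.x i) = a (h • D.x j) (D.x i) * g h := by
      rw [S.smul_arrow, hi']
    have hτ' : τ (D.x i) (h • D.x j) = τ (D.x i) (D.x j) := by
      have := hτ h (D.x i) (D.x j)
      rwa [hi'] at this
    have hχ : ((D.χ z h : kˣ) : k) ≠ 0 := Units.ne_zero _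
    rw [one_smul, hτ', mul_smul_comm, smul_mul_assoc]
    congr 1
    have hp : D.charIdem e g z = ((D.χ z h : kˣ) : k)⁻¹ • (g h * D.charIdem e g z) := by
      rw [D.g_mul_charIdem hh, smul_smul, inv_mul_cancel₀ hχ, one_smul]
    calc _ = D.charIdem e g z * a (D.x i) (h • D.x j) * a (h • D.x j) (D.x i) *
          (((D.χ z h : kˣ) : k)⁻¹ • (g h * D.charIdem e g z)) := by
          rw [← hp]; simp only [mul_assoc]
      _ = ((D.χ z h : kˣ) : k)⁻¹ • (D.charIdem e g z * a (D.x i) (h • D.x j) *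
          (a (h • D.x j) (D.x i) * g h) * D.charIdem e g z) := by
          rw [mul_smul_comm]; simp only [mul_assoc]
      _ = ((D.χ z h : kˣ) : k)⁻¹ • (D.charIdem e g z * (a (D.x i) (h • D.x j) * g h) *
          a (D.x j) (D.x i) * D.charIdem e g z) := by
          rw [← ha']; simp only [mul_assoc]
      _ = ((D.χ z h : kˣ) : k)⁻¹ • ((D.charIdem e g z * g h) * a (D.x i) (D.x j) *
          a (D.x j) (D.x i) * D.charIdem e g z) := by
          rw [← ha]; simp only [mul_assoc]
      _ = _ := by
          rw [D.charIdem_mul_g S hh]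
          simp only [smul_mul_assoc, smul_smul, inv_mul_cancel₀ hχ, one_smul, mul_assoc]
  have h3 : ((D.stab i).card : k) • ∑ j, (τ (D.x i) (D.x j) * ((D.stab₂ i j).card : k)⁻¹) •
      (D.charIdem e g z * a (D.x i) (D.x j) * (a (D.x j) (D.x i) * D.charIdem e g z)) = 0 := by
    rw [h1, Finset.smul_sum]
    refine Finset.sum_congr rfl fun j _ => ?_
    rw [Finset.sum_congr rfl (h2 j), Finset.sum_const, ← Nat.cast_smul_eq_nsmul k, smul_smul,
      smul_smul, smul_smul]
    congr 1
    ring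
  exact (smul_eq_zero.1 h3).resolve_left (D.card_stab_ne i)

lemma baseIdem_isIdempotentElem [Fintype I] : IsIdempotentElem (D.baseIdem e) := by
  classical
  unfold IsIdempotentElem baseIdem
  rw [Finset.sum_mul_sum]
  refine Finset.sum_congr rfl fun i _ => ?_
  rw [Finset.sum_eq_single i (fun j _ hj => S.mul_of_ne _ _ (fun h => hj (D.x_injective h).symm))
    (by simp), S.mul_self]

lemma baseIdem_mul_e [Fintype I] (i : I) : D.baseIdem e * e (D.x i) = e (D.x i) := by
  rw [baseIdem, Finset.sum_mul, Finset.sum_eq_single i (fun j _ hj =>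
    S.mul_of_ne _ _ (fun h => hj (D.x_injective h))) (by simp), S.mul_self]

lemma e_mul_baseIdem [Fintype I] (i : I) : e (D.x i) * D.baseIdem e = e (D.x i) := by
  rw [baseIdem, Finset.mul_sum, Finset.sum_eq_single i (fun j _ hj =>
    S.mul_of_ne _ _ (fun h => hj (D.x_injective h).symm)) (by simp), S.mul_self]

lemma baseIdem_mul_charIdem [Fintype I] (z : W) :
    D.baseIdem e * D.charIdem e g z = D.charIdem e g z := by
  rw [← D.e_mul_charIdem S, ← mul_assoc, D.baseIdem_mul_e S]

lemma charIdem_mul_baseIdem [Fintype I] (z : W) :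
    D.charIdem e g z * D.baseIdem e = D.charIdem e g z := by
  rw [← D.charIdem_mul_e S, mul_assoc, D.e_mul_baseIdem S]

/-- The idempotents of the second graph, in the corner ring. -/
noncomputable def cornerVertex [Fintype I] (z : W) : (D.baseIdem_isIdempotentElem S).Corner :=
  (D.baseIdem_isIdempotentElem S).toCorner (D.charIdem e g z) (D.baseIdem_mul_charIdem S z)
    (D.charIdem_mul_baseIdem S z)

/-- The arrows of the second graph, in the corner ring. -/
noncomputable def cornerArrow [Fintype I] (z w : W) : (D.baseIdem_isIdempotentElem S).Corner :=
  (D.baseIdem_isIdempotentElem S).toCorner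
    (D.charIdem e g z * a (D.x (D.ρ z)) (D.x (D.ρ w)) * D.charIdem e g w)
    (by rw [← mul_assoc, ← mul_assoc, D.baseIdem_mul_charIdem S z])
    (by rw [mul_assoc, D.charIdem_mul_baseIdem S w])

lemma cornerFamily [Fintype I] (hτ : ∀ (γ : Γ) v w, τ (γ • v) (γ • w) = τ v w) :
    IsPreprojFamily adjW (D.dualWeight τ) (D.cornerVertex S) (D.cornerArrow S) := by
  classical
  have hinj := (D.baseIdem_isIdempotentElem S).cornerVal_injective (k := k)
  have hp : ∀ z, D.charIdem e g z * D.charIdem e g z = D.charIdem e g z := fun z => by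
    rw [D.charIdem_mul_charIdem S, if_pos rfl]
  refine ⟨fun z => hinj (hp z), fun z w hzw => hinj ?_, hinj ?_, fun z w => hinj ?_,
    fun z w => hinj ?_, fun z w hzw => hinj ?_, fun z => hinj ?_⟩
  · rw [IsIdempotentElem.cornerVal_mul, map_zero]
    exact (D.charIdem_mul_charIdem S z w).trans (if_neg hzw)
  · rw [map_sum, IsIdempotentElem.cornerVal_one]
    exact D.sum_charIdem
  · simp only [IsIdempotentElem.cornerVal_mul, cornerVertex, cornerArrow,
      IsIdempotentElem.cornerVal_toCorner]
    rw [← mul_assoc, ← mul_assoc, hp]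
  · simp only [IsIdempotentElem.cornerVal_mul, cornerVertex, cornerArrow,
      IsIdempotentElem.cornerVal_toCorner]
    rw [mul_assoc, hp]
  · rw [map_zero]
    exact D.charIdem_mul_arrow_mul_eq_zero S hzw
  -- Grouping the vertices by fibers and inserting the decomposition of `e (D.x j)` into character
  -- idempotents between the two arrows reduces the relation to `charIdem_rel`.
  · rw [map_sum, map_zero, ← D.charIdem_rel S hτ z, ← Finset.sum_fiberwise (g := D.ρ)]
    refine Finset.sum_congr rfl fun j _ => ?_
    rw [← S.mul_vertex (D.x (D.ρ z)) (D.x j), ← D.sum_fiber_charIdem (e := e) (g := g) j,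
      Finset.mul_sum, Finset.mul_sum, Finset.sum_mul, Finset.smul_sum]
    refine Finset.sum_congr rfl fun w hw => ?_
    obtain rfl : D.ρ w = j := (Finset.mem_filter.1 hw).2
    simp only [map_smul, IsIdempotentElem.cornerVal_mul, cornerArrow,
      IsIdempotentElem.cornerVal_toCorner, dualWeight]
    congr 1
    rw [mul_assoc _ (D.charIdem e g w), ← mul_assoc (D.charIdem e g w),
      ← mul_assoc (D.charIdem e g w), hp]
    simp only [mul_assoc]

end

end OrbitDuality

/-! ### The functor M ↦ εM -/

section CornerFunctor

open scoped ModuleCat.Algebra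

variable {k : Type*} [Field k] {A : Type*} [Ring A] [Algebra k A] {B : Type*} [Ring B]
  [Algebra k B] {ε : A} {hε : IsIdempotentElem ε} (φ : B →ₐ[k] hε.Corner)

lemma isFinDim_of_injective (M : ModuleCat B) {N : Type*} [AddCommGroup N] [Module k N]
    [Module.Finite k N] (f : M →+ N) (hf : ∀ (c : k) m, f (algebraMap k B c • m) = c • f m)
    (hi : Function.Injective f) : ModuleCat.isFinDim k B M :=
  Module.Finite.of_injective ({ f with map_smul' := hf } : M →ₗ[k] N) hi

lemma isFinDim_of_surjective (M : ModuleCat B) {N : Type*} [AddCommGroup N] [Module k N]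
    [Module.Finite k N] (f : N →+ M) (hf : ∀ (c : k) n, f (c • n) = algebraMap k B c • f n)
    (hs : Function.Surjective f) : ModuleCat.isFinDim k B M :=
  Module.Finite.of_surjective ({ f with map_smul' := hf } : N →ₗ[k] M) hs

/-- The subgroup `ε M` of an `A`-module `M`. -/
def cornerSubgroup (ε : A) (M : Type*) [AddCommGroup M] [Module A M] : AddSubgroup M where
  carrier := {m | ε • m = m}
  zero_mem' := smul_zero ε
  add_mem' {m n} hm hn := by
    change ε • (m + n) = m + n
    rw [smul_add, hm, hn]
  neg_mem' {m} hm := by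
    change ε • (-m) = -m
    rw [smul_neg, hm]

/-- The `B`-module `ε M`, for a homomorphism from `B` to the corner ring of `ε`. -/
@[nolint unusedArguments]
def CornerModule (_ : B →ₐ[k] hε.Corner) (M : Type*) [AddCommGroup M] [Module A M] : Type _ :=
  cornerSubgroup ε M

namespace CornerModule

variable {M : Type*} [AddCommGroup M] [Module A M]

instance : AddCommGroup (CornerModule φ M) :=
  inferInstanceAs (AddCommGroup (cornerSubgroup ε M))

/-- The inclusion of `ε M` into `M`. -/
def val (m : CornerModule φ M) : M := m.1

lemma val_injective : Function.Injective (val φ (M := M)) := Subtype.val_injective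

lemma smul_val (m : CornerModule φ M) : ε • m.val = m.val := m.2

/-- An element of `ε M`. -/
def mk (m : M) (h : ε • m = m) : CornerModule φ M := ⟨m, h⟩

/-- The projection of `M` onto `ε M`. -/
def proj (m : M) : CornerModule φ M :=
  ⟨ε • m, by change ε • ε • m = ε • m; rw [← mul_smul, hε.eq]⟩

@[simp] lemma val_proj (m : M) : (proj φ m).val = ε • m := rfl

@[simp] lemma val_add (m n : CornerModule φ M) : (m + n).val = m.val + n.val := rfl

lemma val_zero : (0 : CornerModule φ M).val = 0 := rfl

noncomputable instance : Module B (CornerModule φ M) where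
  -- The projection only supplies membership in εM; `val_smul` shows that it changes nothing.
  smul b m := proj φ (hε.cornerVal k (φ b) • m.val)
  one_smul m := val_injective φ (by
    change ε • hε.cornerVal k (φ 1) • m.val = m.val
    rw [map_one, IsIdempotentElem.cornerVal_one, smul_val, smul_val])
  mul_smul b c m := val_injective φ (by
    change ε • hε.cornerVal k (φ (b * c)) • m.val =
      ε • hε.cornerVal k (φ b) • ε • hε.cornerVal k (φ c) • m.val
    rw [map_mul, IsIdempotentElem.cornerVal_mul, mul_smul, ← mul_smul ε (hε.cornerVal k (φ c)),
      hε.mul_cornerVal])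
  smul_zero b := val_injective φ (by
    change ε • hε.cornerVal k (φ b) • (0 : CornerModule φ M).val = 0
    rw [val_zero, smul_zero, smul_zero])
  smul_add b m n := val_injective φ (by
    change ε • hε.cornerVal k (φ b) • (m + n).val =
      ε • hε.cornerVal k (φ b) • m.val + ε • hε.cornerVal k (φ b) • n.val
    rw [val_add, smul_add, smul_add])
  add_smul b c m := val_injective φ (by
    change ε • hε.cornerVal k (φ (b + c)) • m.val =
      ε • hε.cornerVal k (φ b) • m.val + ε • hε.cornerVal k (φ c) • m.val
    rw [map_add, map_add, add_smul, smul_add])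
  zero_smul m := val_injective φ (by
    change ε • hε.cornerVal k (φ 0) • m.val = 0
    rw [map_zero, map_zero, zero_smul, smul_zero])

@[simp] lemma val_smul (b : B) (m : CornerModule φ M) :
    (b • m).val = hε.cornerVal k (φ b) • m.val := by
  change ε • hε.cornerVal k (φ b) • m.val = _
  rw [← mul_smul, hε.mul_cornerVal]

lemma val_algebraMap_smul (c : k) (m : CornerModule φ M) :
    (algebraMap k B c • m).val = algebraMap k A c • m.val := by
  rw [val_smul, AlgHom.commutes, Algebra.algebraMap_eq_smul_one, map_smul,
    IsIdempotentElem.cornerVal_one, ← smul_val, ← mul_smul, ← mul_smul, smul_mul_assoc, hε.eq,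
    Algebra.smul_def]

variable {N : Type*} [AddCommGroup N] [Module A N]

/-- The restriction of a homomorphism `M → N` to `ε M → ε N`. -/
noncomputable def map (f : M →ₗ[A] N) : CornerModule φ M →ₗ[B] CornerModule φ N where
  toFun m := mk φ (f m.val) (by rw [← map_smul, smul_val])
  map_add' m n := val_injective φ (map_add f m.val n.val)
  map_smul' b m := val_injective φ (by
    change f (b • m).val = (b • mk φ (f m.val) _).val
    rw [val_smul, map_smul, val_smul]
    rfl)

end CornerModule

/-- The functor `M ↦ ε M` between categories of finite-dimensional modules. -/
noncomputable def cornerFunctor : FinDimModuleCat.{v} k A ⥤ FinDimModuleCat.{v} k B where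
  obj M := ⟨ModuleCat.of B (CornerModule φ M.obj), by
    have : Module.Finite k M.obj := M.property
    exact isFinDim_of_injective _ (AddMonoidHom.mk' (CornerModule.val φ) (CornerModule.val_add φ))
      (fun c m => (CornerModule.val_algebraMap_smul φ c m).trans (algebraMap_smul A c m.val))
      (CornerModule.val_injective φ)⟩
  map f := ObjectProperty.homMk (ModuleCat.ofHom (CornerModule.map φ f.hom.hom))
  map_id M := rfl
  map_comp f g := rfl

instance : (cornerFunctor.{v} φ).Linear k where
  map_smul {M N} f c := by
    ext m
    apply CornerModule.val_injective φ
    exact (CornerModule.val_algebraMap_smul φ c (CornerModule.map φ f.hom.hom m)).symm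

/-- The hypothesis says that ε is full, so εM generates M over A and a homomorphism is determined by
its restriction to εM. -/
lemma cornerFunctor_faithful {ι : Type*} [Fintype ι] (p q : ι → A)
    (h1 : ∑ i, p i * ε * q i = 1) : (cornerFunctor.{v} φ).Faithful where
  map_injective {M N} f g hfg := by
    ext m
    have h2 : ∀ m, ε • m = m → f.hom.hom m = g.hom.hom m := by
      intro m hm
      have h3 : CornerModule.map φ f.hom.hom = CornerModule.map φ g.hom.hom :=
        congrArg (fun F => F.hom.hom) hfg
      exact congrArg (CornerModule.val φ) (LinearMap.congr_fun h3 ⟨m, hm⟩)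
    rw [← one_smul A m, ← h1, Finset.sum_smul, map_sum, map_sum]
    refine Finset.sum_congr rfl fun i _ => ?_
    have h3 : ε • (ε * q i) • m = (ε * q i) • m := by rw [← mul_smul, ← mul_assoc, hε.eq]
    have h4 : (p i * ε * q i) • m = p i • (ε * q i) • m := by rw [mul_assoc, mul_smul]
    rw [h4]
    exact (map_smul f.hom.hom _ _).trans
      ((congrArg (p i • ·) (h2 _ h3)).trans (map_smul g.hom.hom _ _).symm)

/-- A B-linear map εM → εN is linear over the whole corner ring because φ is surjective onto it.
Writing 1 = ∑ pᵢ ε qᵢ, the only possible A-linear extension is m ↦ ∑ pᵢ h(ε qᵢ m). -/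
lemma cornerFunctor_full {ι : Type*} [Fintype ι] (p q : ι → A)
    (h1 : ∑ i, p i * ε * q i = 1) (hφ : ∀ x, ∃ b, hε.cornerVal k (φ b) = ε * x * ε) :
    (cornerFunctor.{v} φ).Full where
  map_surjective {M N} F := by
    let h : CornerModule φ M.obj →ₗ[B] CornerModule φ N.obj := F.hom.hom
    have hcomm : ∀ x m, (h (CornerModule.proj φ ((ε * x * ε) • m))).val =
        (ε * x * ε) • (h (CornerModule.proj φ m)).val := by
      intro x m
      obtain ⟨b, hb⟩ := hφ x
      have : CornerModule.proj φ ((ε * x * ε) • m) = b • CornerModule.proj φ m := by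
        apply CornerModule.val_injective φ
        rw [CornerModule.val_smul, CornerModule.val_proj, CornerModule.val_proj, hb, ← mul_smul,
          ← mul_smul, mul_assoc _ ε ε, hε.eq, ← mul_assoc, ← mul_assoc, hε.eq]
      rw [this, map_smul, CornerModule.val_smul, hb]
    have hproj : ∀ m n : M.obj, CornerModule.proj φ (m + n) =
        CornerModule.proj φ m + CornerModule.proj φ n := fun m n =>
      CornerModule.val_injective φ (smul_add ε m n)
    let f0 : M.obj →+ N.obj := AddMonoidHom.mk' (fun m => ∑ i, p i • (h (CornerModule.proj φ
      (q i • m))).val) (fun m n => by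
        rw [← Finset.sum_add_distrib]
        refine Finset.sum_congr rfl fun i _ => ?_
        rw [smul_add, hproj, map_add, CornerModule.val_add, smul_add])
    have hadd : ∀ (s : Finset ι) (m : ι → M.obj), (h (CornerModule.proj φ (∑ i ∈ s, m i))).val =
        ∑ i ∈ s, (h (CornerModule.proj φ (m i))).val := fun s m =>
      map_sum (AddMonoidHom.mk' (fun m : M.obj => (h (CornerModule.proj φ m)).val)
        (fun m n => by rw [hproj, map_add, CornerModule.val_add])) m s
    have hpε : ∀ m : M.obj, CornerModule.proj φ (ε • m) = CornerModule.proj φ m := fun m =>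
      CornerModule.val_injective φ (by
        rw [CornerModule.val_proj, CornerModule.val_proj, ← mul_smul, hε.eq])
    let f : M.obj →ₗ[A] N.obj :=
      { toFun := f0
        map_add' := map_add f0
        map_smul' := fun x m => by
          change ∑ i, p i • (h (CornerModule.proj φ (q i • x • m))).val =
            x • ∑ j, p j • (h (CornerModule.proj φ (q j • m))).val
          -- Inserting 1 = ∑ pⱼ ε qⱼ before `m` leaves the corner elements ε qᵢ x pⱼ ε, which
          -- commute with `h`.
          have h2 : ∀ i, (h (CornerModule.proj φ (q i • x • m))).val =
              ∑ j, (ε * (q i * x * p j) * ε) • (h (CornerModule.proj φ (q j • m))).val := by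
            intro i
            rw [← Finset.sum_congr rfl (fun j _ => hcomm (q i * x * p j) (q j • m)), ← hadd,
              ← hpε (q i • x • m)]
            congr 3
            conv_lhs => rw [← one_smul A m, ← h1]
            simp only [Finset.sum_smul, Finset.smul_sum, ← mul_smul, mul_assoc]
          simp only [h2, Finset.smul_sum]
          rw [Finset.sum_comm]
          refine Finset.sum_congr rfl fun j _ => ?_
          have h3 : ∀ n : N.obj, ∑ i, p i • (ε * (q i * x * p j) * ε) • n =
              x • p j • ε • n := by
            intro n
            conv_rhs => rw [← one_smul A (x • p j • ε • n), ← h1]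
            rw [Finset.sum_smul]
            simp only [← mul_smul, mul_assoc]
          rw [h3, CornerModule.smul_val φ] }
    refine ⟨ObjectProperty.homMk (ModuleCat.ofHom f), ?_⟩
    ext m
    apply CornerModule.val_injective φ
    change ∑ i, p i • (h (CornerModule.proj φ (q i • CornerModule.val φ m))).val =
      (h m).val
    have h4 : ∀ i, (h (CornerModule.proj φ (q i • CornerModule.val φ m))).val =
        (ε * q i * ε) • (h m).val := by
      intro i
      have h5 : CornerModule.proj φ (CornerModule.val φ m) = m :=
        CornerModule.val_injective φ (CornerModule.smul_val φ m)
      have h6 := hcomm (q i) (CornerModule.val φ m)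
      rw [mul_assoc, mul_smul, mul_smul, hpε,
        CornerModule.smul_val φ m, h5] at h6
      rw [h6, mul_assoc]
    simp only [h4]
    conv_rhs => rw [← one_smul A (h m).val, ← h1, Finset.sum_smul]
    refine Finset.sum_congr rfl fun i _ => ?_
    conv_rhs => rw [← CornerModule.smul_val φ]
    simp only [← mul_smul, mul_assoc]

/-- Representations as homomorphisms into `Module.End` suit algebras given by generators and
relations. The map θ may have a kernel; only its restriction to εM has to be bijective. -/
lemma cornerFunctor_essSurj
    (H : ∀ (N : Type v) [AddCommGroup N] [Module k N] [Module.Finite k N]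
      (ψ : B →ₐ[k] Module.End k N),
      ∃ (M : Type v) (_ : AddCommGroup M) (_ : Module k M) (_ : Module.Finite k M)
        (η : A →ₐ[k] Module.End k M) (θ : M →ₗ[k] N),
        (∀ b m, θ (η (hε.cornerVal k (φ b)) m) = ψ b (θ m)) ∧
        (∀ m, η ε m = m → θ m = 0 → m = 0) ∧ (∀ n, ∃ m, η ε m = m ∧ θ m = n)) :
    (cornerFunctor.{v} φ).EssSurj where
  mem_essImage N := by
    have : Module.Finite k N.obj := N.property
    obtain ⟨M, _, _, hM, η, θ, h1, h2, h3⟩ := H N.obj (Algebra.lsmul k k N.obj)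
    let _ : Module A M := Module.compHom M η.toRingHom
    have hsm : ∀ (x : A) (m : M), x • m = η x m := fun _ _ => rfl
    let M' : FinDimModuleCat.{v} k A := ⟨ModuleCat.of A M, by
      exact isFinDim_of_surjective (ModuleCat.of A M) (AddMonoidHom.id M) (fun c m => by
        change c • m = η (algebraMap k A c) m
        rw [AlgHom.commutes]; rfl) Function.surjective_id⟩
    let e : CornerModule φ M →ₗ[B] N.obj :=
      { toFun := fun m => θ m.val
        map_add' := fun m n => by rw [CornerModule.val_add, map_add]
        map_smul' := fun b m => by
          rw [CornerModule.val_smul, hsm, h1]; rfl }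
    have he : Function.Bijective e := by
      constructor
      · rw [injective_iff_map_eq_zero]
        intro m hm
        exact CornerModule.val_injective φ (h2 _ (CornerModule.smul_val φ m) hm)
      · intro n
        obtain ⟨m, hm, hn⟩ := h3 n
        exact ⟨⟨m, hm⟩, hn⟩
    exact ⟨M', ⟨ObjectProperty.isoMk _ (LinearEquiv.ofBijective e he).toModuleIso⟩⟩

end CornerFunctor

/-! ### Fullness of the base idempotent and generation of its corner -/

namespace OrbitDuality

variable {k : Type*} [Field k] {Γ : Type*} [Group Γ] [Fintype Γ] {V W : Type*}
  [Fintype W] [MulAction Γ V] {I : Type*} {adjV : V → V → Prop}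
  {adjW : W → W → Prop} (D : OrbitDuality k Γ I adjV adjW)

/-- A group element that maps the base point to the given vertex. -/
noncomputable def trans (v : V) : Γ := (D.exists_smul v).choose

lemma trans_smul (v : V) : D.trans v • D.x (D.π v) = v := (D.exists_smul v).choose_spec

variable {τ : V → V → k} {A : Type*} [Ring A] [Algebra k A] {e : V → A} {a : V → V → A}
  {g : Γ →* A} [Fintype V] (S : IsSkewFamily adjV τ e a g)
include S

lemma vertex_eq (v : V) : e v = g (D.trans v) * e (D.x (D.π v)) * g (D.trans v)⁻¹ := by
  rw [S.smul_vertex, D.trans_smul, mul_assoc, ← map_mul, mul_inv_cancel, map_one, mul_one]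

/-- Each vertex is a translate of a base point, so each vertex idempotent lies in the ideal
generated by the base idempotent; the explicit factors serve the corner functor. -/
lemma sum_baseIdem_eq_one [Fintype I] :
    ∑ v, g (D.trans v) * D.baseIdem e * (e (D.x (D.π v)) * g (D.trans v)⁻¹) = 1 := by
  rw [← S.sum_eq_one]
  refine Finset.sum_congr rfl fun v _ => ?_
  rw [D.vertex_eq S v, ← mul_assoc, mul_assoc (g (D.trans v)), D.baseIdem_mul_e S]

/-- The corner ring is generated by the idempotents and the arrows of the second graph. -/
lemma exists_cornerVal_eq [Fintype I] {B : Type*} [Ring B] [Algebra k B]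
    (φ : B →ₐ[k] (D.baseIdem_isIdempotentElem S).Corner)
    (hgen : ∀ T : Subalgebra k A, (∀ v, e v ∈ T) → (∀ v w, a v w ∈ T) → (∀ γ, g γ ∈ T) →
      ∀ y, y ∈ T)
    (hv : ∀ z, ∃ b, φ b = D.cornerVertex S z) (ha : ∀ z w, ∃ b, φ b = D.cornerArrow S z w)
    (y : A) : ∃ b, (D.baseIdem_isIdempotentElem S).cornerVal k (φ b) =
      D.baseIdem e * y * D.baseIdem e := by
  classical
  let P : Submodule k A :=
    LinearMap.range (((D.baseIdem_isIdempotentElem S).cornerVal k).comp φ.toLinearMap)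
  have hmul : ∀ y ∈ P, ∀ y' ∈ P, y * y' ∈ P := by
    rintro _ ⟨b, rfl⟩ _ ⟨b', rfl⟩
    refine ⟨b * b', ?_⟩
    simp
  have hpP : ∀ z, D.charIdem e g z ∈ P := fun z => by
    obtain ⟨b, hb⟩ := hv z
    exact ⟨b, congrArg ((D.baseIdem_isIdempotentElem S).cornerVal k) hb⟩
  have hbP : ∀ i j, a (D.x i) (D.x j) ∈ P := by
    intro i j
    rw [← S.vertex_mul, ← S.mul_vertex, ← D.sum_fiber_charIdem (e := e) (g := g) i,
      ← D.sum_fiber_charIdem (e := e) (g := g) j, Finset.mul_sum, Finset.mul_sum]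
    refine P.sum_mem fun w hw => ?_
    rw [Finset.sum_mul]
    refine P.sum_mem fun z hz => ?_
    obtain ⟨b, hb⟩ := ha z w
    refine ⟨b, ?_⟩
    rw [← D.mem_fiber.1 hz, ← D.mem_fiber.1 hw, ← mul_assoc]
    exact congrArg ((D.baseIdem_isIdempotentElem S).cornerVal k) hb
  have hgP : ∀ γ i j, e (D.x i) * g γ * e (D.x j) ∈ P := by
    intro γ i j
    rw [mul_assoc, S.smul_vertex, ← mul_assoc]
    by_cases h : D.x i = γ • D.x j
    · obtain rfl : i = j := by
        have := congrArg D.π h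
        rwa [D.π_smul, D.π_x, D.π_x] at this
      rw [← h, S.mul_self, ← D.g_mul_e S (D.mem_stab.2 h.symm),
        ← D.sum_fiber_charIdem (e := e) (g := g) i, Finset.mul_sum]
      refine P.sum_mem fun z hz => ?_
      rw [D.g_mul_charIdem (by rw [D.mem_fiber.1 hz, D.mem_stab, ← h])]
      exact P.smul_mem _ (hpP z)
    · rw [S.mul_of_ne _ _ h, zero_mul]
      exact P.zero_mem
  -- Conjugation by group elements brings all vertices to base points. Closure under products holds
  -- because 1 is the sum of the `e v`, each a conjugate of a base idempotent, so a product splits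
  -- into products inside `P`.
  let T : Subalgebra k A :=
    { carrier := {y | ∀ γ δ i j, e (D.x i) * g γ * y * (g δ * e (D.x j)) ∈ P}
      mul_mem' := fun {y y'} hy hy' γ δ i j => by
        have h1 : e (D.x i) * g γ * (y * y') * (g δ * e (D.x j)) =
            e (D.x i) * g γ * y * (∑ v, e v) * y' * (g δ * e (D.x j)) := by
          rw [S.sum_eq_one]; simp only [mul_assoc, one_mul]
        rw [h1, Finset.mul_sum, Finset.sum_mul, Finset.sum_mul]
        refine P.sum_mem fun v _ => ?_
        have h2 := hmul _ (hy γ (D.trans v) i (D.π v)) _ (hy' (D.trans v)⁻¹ δ (D.π v) j)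
        rw [D.vertex_eq S v, ← S.mul_self (D.x (D.π v))]
        simpa only [mul_assoc] using h2
      add_mem' := fun {y y'} hy hy' γ δ i j => by
        rw [mul_add, add_mul]
        exact P.add_mem (hy γ δ i j) (hy' γ δ i j)
      algebraMap_mem' := fun c γ δ i j => by
        rw [Algebra.algebraMap_eq_smul_one, mul_smul_comm, mul_one, smul_mul_assoc, ← mul_assoc,
          mul_assoc (e _), ← map_mul]
        exact P.smul_mem _ (hgP _ _ _) }
  have hT : y ∈ T := by
    refine hgen T (fun v γ δ i j => ?_) (fun v w γ δ i j => ?_) (fun γ' γ δ i j => ?_) y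
    · rw [mul_assoc (e _), S.smul_vertex, ← mul_assoc (e _), ← mul_assoc, mul_assoc _ (g γ),
        ← map_mul]
      by_cases h : D.x i = γ • v
      · rw [← h, S.mul_self]
        exact hgP _ _ _
      · rw [S.mul_of_ne _ _ h, zero_mul, zero_mul]
        exact P.zero_mem
    · by_cases h : adjV v w
      -- An arrow is the conjugate by σ of an arrow between base points, which is covered by `hbP`.
      · obtain ⟨-, σ, h1, h2⟩ := (D.adjV_iff v w).1 h
        have h3 : a v w = g σ * (e (D.x (D.π v)) * a (D.x (D.π v)) (D.x (D.π w)) *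
            e (D.x (D.π w))) * g σ⁻¹ := by
          rw [S.vertex_mul, S.mul_vertex, S.smul_arrow, h1, h2, mul_assoc, ← map_mul,
            mul_inv_cancel, map_one, mul_one]
        have h4 := hmul _ (hmul _ (hgP (γ * σ) i (D.π v)) _ (hbP (D.π v) (D.π w))) _
          (hgP (σ⁻¹ * δ) (D.π w) j)
        rw [h3]
        simpa only [mul_assoc, map_mul] using h4
      · rw [S.eq_zero _ _ h, mul_zero, zero_mul]
        exact P.zero_mem
    · rw [← mul_assoc, mul_assoc (e _), ← map_mul, mul_assoc (e _), ← map_mul]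
      exact hgP _ _ _
  have h : D.baseIdem e * y * D.baseIdem e ∈ P := by
    rw [baseIdem, Finset.sum_mul, Finset.sum_mul_sum]
    refine P.sum_mem fun i _ => P.sum_mem fun j _ => ?_
    have := hT 1 1 i j
    rwa [map_one, mul_one, one_mul] at this
  exact h

end OrbitDuality

/-! ### Stabilizers acting through a family on the dual graph -/

namespace OrbitDuality

variable {k : Type*} [Field k] {Γ : Type*} [Group Γ] [Fintype Γ] {V W : Type*}
  [Fintype W] [MulAction Γ V] {I : Type*} {adjV : V → V → Prop}
  {adjW : W → W → Prop} (D : OrbitDuality k Γ I adjV adjW)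
  {τ : V → V → k} {R : Type*} [Ring R] [Algebra k R] {e : W → R} {a : W → W → R}

/-- The action of the stabilizer of a base point determined by a family of idempotents. -/
noncomputable def stabAct (e : W → R) (i : I) (h : Γ) : R :=
  ∑ z ∈ D.fiber i, ((D.χ z h : kˣ) : k) • e z

/-- The sum of the arrows between two fibers. -/
noncomputable def fiberArrow (a : W → W → R) (i j : I) : R :=
  ∑ z ∈ D.fiber i, ∑ w ∈ D.fiber j, a z w

lemma stabAct_eq (i : I) (h : Γ) :
    D.stabAct e i h = ∑ z ∈ D.fiber i, ((D.χ z h : kˣ) : k) • e z := rfl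

/-- Fourier inversion on the stabilizer recovers the single idempotents from the group action. -/
lemma vertex_eq_sum_stabAct {z : W} {i : I} (hz : z ∈ D.fiber i) :
    ((D.stab i).card : k)⁻¹ • ∑ h ∈ D.stab i, ((D.χ z h⁻¹ : kˣ) : k) • D.stabAct e i h = e z := by
  classical
  obtain rfl := D.mem_fiber.1 hz
  have h1 : ∑ h ∈ D.stab (D.ρ z), ((D.χ z h⁻¹ : kˣ) : k) • D.stabAct e (D.ρ z) h =
      ∑ w ∈ D.fiber (D.ρ z), (if z = w then ((D.stab (D.ρ z)).card : k) else 0) • e w := by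
    simp only [stabAct, Finset.smul_sum]
    rw [Finset.sum_comm]
    refine Finset.sum_congr rfl fun w hw => ?_
    rw [← D.sum_stab_character (D.mem_fiber.1 hw).symm, Finset.sum_smul]
    simp only [smul_smul, Units.val_mul]
  rw [h1]
  simp [ite_smul, hz, smul_smul, inv_mul_cancel₀ (D.card_stab_ne _)]

section

variable (F : IsPreprojFamily adjW (D.dualWeight τ) e a)
include F

lemma stabAct_mul_vertex {z : W} {i : I} (hz : z ∈ D.fiber i) (h : Γ) :
    D.stabAct e i h * e z = ((D.χ z h : kˣ) : k) • e z := by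
  rw [stabAct, Finset.sum_mul, Finset.sum_eq_single z]
  · rw [smul_mul_assoc, F.mul_self]
  · intro w _ hw
    rw [smul_mul_assoc, F.mul_of_ne _ _ hw, smul_zero]
  · exact fun h => absurd hz h

lemma vertex_mul_stabAct {z : W} {i : I} (hz : z ∈ D.fiber i) (h : Γ) :
    e z * D.stabAct e i h = ((D.χ z h : kˣ) : k) • e z := by
  rw [stabAct, Finset.mul_sum, Finset.sum_eq_single z]
  · rw [mul_smul_comm, F.mul_self]
  · intro w _ hw
    rw [mul_smul_comm, F.mul_of_ne _ _ hw.symm, smul_zero]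
  · exact fun h => absurd hz h

lemma stabAct_mul (i : I) (g h : Γ) :
    D.stabAct e i g * D.stabAct e i h = D.stabAct e i (g * h) := by
  rw [D.stabAct_eq i h, D.stabAct_eq i (g * h), Finset.mul_sum]
  refine Finset.sum_congr rfl fun z hz => ?_
  rw [mul_smul_comm, D.stabAct_mul_vertex F hz, smul_smul, map_mul, Units.val_mul, mul_comm]

lemma stabAct_mul_of_ne {i j : I} (hij : i ≠ j) (g h : Γ) :
    D.stabAct e i g * D.stabAct e j h = 0 := by
  rw [stabAct, stabAct, Finset.sum_mul_sum]
  refine Finset.sum_eq_zero fun z hz => Finset.sum_eq_zero fun w hw => ?_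
  rw [smul_mul_smul_comm, F.mul_of_ne, smul_zero]
  rintro rfl
  exact hij ((D.mem_fiber.1 hz).symm.trans (D.mem_fiber.1 hw))

lemma sum_stabAct_one [Fintype I] : ∑ i, D.stabAct e i 1 = 1 := by
  classical
  rw [← F.sum_eq_one, ← Finset.sum_fiberwise (g := D.ρ)]
  refine Finset.sum_congr rfl fun i _ => ?_
  simp only [stabAct, map_one, Units.val_one, one_smul]
  rfl

lemma stabAct_one_mul_fiberArrow (i j : I) :
    D.stabAct e i 1 * D.fiberArrow a i j = D.fiberArrow a i j := by
  rw [fiberArrow, Finset.mul_sum]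
  refine Finset.sum_congr rfl fun z hz => ?_
  rw [Finset.mul_sum]
  refine Finset.sum_congr rfl fun w _ => ?_
  rw [← F.vertex_mul, ← mul_assoc, D.stabAct_mul_vertex F hz, map_one, Units.val_one, one_smul]

lemma fiberArrow_mul_stabAct_one (i j : I) :
    D.fiberArrow a i j * D.stabAct e j 1 = D.fiberArrow a i j := by
  rw [fiberArrow, Finset.sum_mul]
  refine Finset.sum_congr rfl fun z _ => ?_
  rw [Finset.sum_mul]
  refine Finset.sum_congr rfl fun w hw => ?_
  rw [← F.mul_vertex, mul_assoc, D.vertex_mul_stabAct F hw, map_one, Units.val_one, one_smul]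

/-- Adjacent characters agree on the common stabilizer, so both sides scale each `a z w` by the same
number. -/
lemma fiberArrow_mul_stabAct {i j : I} {h : Γ} (hi : h ∈ D.stab i) (hj : h ∈ D.stab j) :
    D.fiberArrow a i j * D.stabAct e j h = D.stabAct e i h * D.fiberArrow a i j := by
  rw [fiberArrow, Finset.sum_mul, Finset.mul_sum]
  refine Finset.sum_congr rfl fun z hz => ?_
  rw [Finset.sum_mul, Finset.mul_sum]
  refine Finset.sum_congr rfl fun w hw => ?_
  by_cases hzw : adjW z w
  · obtain rfl := D.mem_fiber.1 hz
    obtain rfl := D.mem_fiber.1 hw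
    rw [← F.mul_vertex, mul_assoc, D.vertex_mul_stabAct F hw, mul_smul_comm, F.mul_vertex,
      ← F.vertex_mul, ← mul_assoc, D.stabAct_mul_vertex F hz, smul_mul_assoc,
      ((D.adjW_iff z w).1 hzw).2 h (D.mem_stab.1 hi) (D.mem_stab.1 hj)]
  · rw [F.eq_zero _ _ hzw, zero_mul, mul_zero]

lemma fiberArrow_eq_zero {i j : I} (hij : ¬ D.R i j) : D.fiberArrow a i j = 0 := by
  refine Finset.sum_eq_zero fun z hz => Finset.sum_eq_zero fun w hw => F.eq_zero _ _ fun h => ?_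
  obtain rfl := D.mem_fiber.1 hz
  obtain rfl := D.mem_fiber.1 hw
  exact hij ((D.adjW_iff z w).1 h).1

lemma vertex_mul_fiberArrow {z : W} {i j : I} (hz : z ∈ D.fiber i) :
    e z * D.fiberArrow a i j = ∑ w ∈ D.fiber j, a z w := by
  rw [fiberArrow, Finset.mul_sum, Finset.sum_eq_single z]
  · rw [Finset.mul_sum]
    exact Finset.sum_congr rfl fun w _ => F.vertex_mul _ _
  · intro w _ hw
    rw [Finset.mul_sum]
    exact Finset.sum_eq_zero fun l _ => F.vertex_mul_of_ne hw.symm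
  · exact fun h => absurd hz h

lemma fiberArrow_mul_vertex {z : W} {i j : I} (hz : z ∈ D.fiber j) :
    D.fiberArrow a i j * e z = ∑ w ∈ D.fiber i, a w z := by
  rw [fiberArrow, Finset.sum_mul]
  refine Finset.sum_congr rfl fun w _ => ?_
  rw [Finset.sum_mul, Finset.sum_eq_single z]
  · rw [F.mul_vertex]
  · exact fun l _ hl => F.mul_vertex_of_ne hl
  · exact fun h => absurd hz h

lemma vertex_mul_fiberArrow_mul_vertex {z w : W} {i j : I} (hz : z ∈ D.fiber i)
    (hw : w ∈ D.fiber j) : e z * D.fiberArrow a i j * e w = a z w := by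
  rw [D.vertex_mul_fiberArrow F hz, Finset.sum_mul, Finset.sum_eq_single w]
  · rw [F.mul_vertex]
  · exact fun l _ hl => F.mul_vertex_of_ne hl
  · exact fun h => absurd hw h

/-- Averaging over conjugates by the stabilizer kills the blocks between different characters, by
orthogonality, and leaves the diagonal ones. -/
lemma sum_conj_fiberArrow (i j : I) :
    ∑ h ∈ D.stab i, D.stabAct e i h * (D.fiberArrow a i j * D.fiberArrow a j i) *
      D.stabAct e i h⁻¹ =
    ((D.stab i).card : k) • ∑ z ∈ D.fiber i, ∑ w ∈ D.fiber j, a z w * a w z := by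
  classical
  set X := D.fiberArrow a i j * D.fiberArrow a j i with hX
  have h1 : ∀ h, D.stabAct e i h * X * D.stabAct e i h⁻¹ =
      ∑ z ∈ D.fiber i, ∑ z' ∈ D.fiber i,
        ((D.χ z' h⁻¹ * D.χ z h : kˣ) : k) • (e z * X * e z') := by
    intro h
    rw [stabAct, stabAct, Finset.sum_mul, Finset.sum_mul_sum]
    refine Finset.sum_congr rfl fun z _ => Finset.sum_congr rfl fun z' _ => ?_
    simp only [smul_mul_assoc, mul_smul_comm, smul_smul, Units.val_mul, mul_comm]
  rw [Finset.sum_congr rfl fun h _ => h1 h, Finset.sum_comm, Finset.smul_sum]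
  refine Finset.sum_congr rfl fun z hz => ?_
  rw [Finset.sum_comm]
  have h2 : ∀ z' ∈ D.fiber i, ∑ h ∈ D.stab i,
      ((D.χ z' h⁻¹ * D.χ z h : kˣ) : k) • (e z * X * e z') =
      (if z' = z then ((D.stab i).card : k) else 0) • (e z * X * e z') := by
    intro z' hz'
    rw [← Finset.sum_smul]
    congr 1
    obtain rfl := D.mem_fiber.1 hz'
    exact D.sum_stab_character (D.mem_fiber.1 hz).symm
  rw [Finset.sum_congr rfl h2]
  simp only [ite_smul, zero_smul, Finset.sum_ite_eq', if_pos hz]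
  congr 1
  rw [hX, ← mul_assoc, D.vertex_mul_fiberArrow F hz, mul_assoc, D.fiberArrow_mul_vertex F hz,
    Finset.sum_mul_sum]
  refine Finset.sum_congr rfl fun w hw => Finset.sum_eq_single_of_mem w hw fun w' _ hne => ?_
  rw [← F.mul_vertex, mul_assoc, F.vertex_mul_of_ne hne.symm, mul_zero]

/-- The relations at all vertices over `i` add up to this averaged relation, which has the same
shape as a sum over the neighbours of a vertex of the first graph. -/
lemma fiberArrow_rel [Fintype I] (i : I) :
    ∑ j, (τ (D.x i) (D.x j) * ((D.stab₂ i j).card : k)⁻¹) • ∑ h ∈ D.stab i,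
      D.stabAct e i h * (D.fiberArrow a i j * D.fiberArrow a j i) * D.stabAct e i h⁻¹ = 0 := by
  classical
  have h1 : ∀ z ∈ D.fiber i, ∑ j, (τ (D.x i) (D.x j) * ((D.stab₂ i j).card : k)⁻¹) •
      ∑ w ∈ D.fiber j, a z w * a w z = 0 := by
    intro z hz
    rw [← F.rel z, ← Finset.sum_fiberwise (g := D.ρ)]
    refine Finset.sum_congr rfl fun j _ => ?_
    rw [Finset.smul_sum]
    refine Finset.sum_congr rfl fun w hw => ?_
    rw [dualWeight, D.mem_fiber.1 hz, D.mem_fiber.1 hw]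
  simp only [D.sum_conj_fiberArrow F, smul_comm _ ((D.stab i).card : k)]
  rw [← Finset.smul_sum]
  simp only [Finset.smul_sum (s := D.fiber i)]
  rw [Finset.sum_comm, Finset.sum_congr rfl h1]
  simp

end

end OrbitDuality

/-! ### The induced module -/

namespace OrbitDuality

variable {k : Type*} [Field k] {Γ : Type*} [Group Γ] [Fintype Γ] {V W : Type*}
  [Fintype W] [MulAction Γ V] {I : Type*} {adjV : V → V → Prop}
  {adjW : W → W → Prop} (D : OrbitDuality k Γ I adjV adjW)
  {τ : V → V → k} {N : Type*} [AddCommGroup N] [Module k N] {e : W → Module.End k N}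
  {a : W → W → Module.End k N}

/-- The functions on the group that are equivariant for the stabilizers of the base points. -/
def inducedSubmodule (e : W → Module.End k N) : Submodule k (Γ → N) where
  -- For each `i` only the component of `m` in the image of `D.stabAct e i 1` is constrained. The
  -- space is thus the direct sum over `i` of these components, each induced from the stabilizer of
  -- `D.x i` to Γ.
  carrier := {m | ∀ i, ∀ h ∈ D.stab i, ∀ γ,
    D.stabAct e i 1 (m (γ * h)) = D.stabAct e i h⁻¹ (m γ)}
  zero_mem' := fun i h _ γ => by simp
  add_mem' {m n} hm hn i h hh γ := by
    simp only [Pi.add_apply, map_add, hm i h hh, hn i h hh]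
  smul_mem' c m hm i h hh γ := by
    simp only [Pi.smul_apply, map_smul, hm i h hh]

lemma stabAct_apply (F : IsPreprojFamily adjW (D.dualWeight τ) e a) (i : I) (g h : Γ) (n : N) :
    D.stabAct e i g (D.stabAct e i h n) = D.stabAct e i (g * h) n := by
  rw [← D.stabAct_mul F]; rfl

lemma stabAct_apply_of_ne (F : IsPreprojFamily adjW (D.dualWeight τ) e a) {i j : I}
    (hij : i ≠ j) (g h : Γ) (n : N) :
    D.stabAct e i g (D.stabAct e j h n) = 0 := by
  rw [← Module.End.mul_apply, D.stabAct_mul_of_ne F hij]; rfl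

lemma stabAct_fiberArrow_apply (F : IsPreprojFamily adjW (D.dualWeight τ) e a) (i j : I)
    (n : N) : D.stabAct e i 1 (D.fiberArrow a i j n) = D.fiberArrow a i j n := by
  rw [← Module.End.mul_apply, D.stabAct_one_mul_fiberArrow F]

lemma fiberArrow_stabAct_apply (F : IsPreprojFamily adjW (D.dualWeight τ) e a) (i j : I)
    (n : N) : D.fiberArrow a i j (D.stabAct e j 1 n) = D.fiberArrow a i j n := by
  rw [← Module.End.mul_apply, D.fiberArrow_mul_stabAct_one F]

lemma fiberArrow_stabAct_comm_apply (F : IsPreprojFamily adjW (D.dualWeight τ) e a) {i j : I}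
    {h : Γ} (hi : h ∈ D.stab i) (hj : h ∈ D.stab j) (n : N) :
    D.fiberArrow a i j (D.stabAct e j h n) = D.stabAct e i h (D.fiberArrow a i j n) := by
  rw [← Module.End.mul_apply, D.fiberArrow_mul_stabAct F hi hj]; rfl

open Classical in
/-- The idempotent of a vertex on the induced module. -/
noncomputable def inducedVertex (F : IsPreprojFamily adjW (D.dualWeight τ) e a) (v : V) :
    Module.End k (D.inducedSubmodule e) where
  toFun m := ⟨fun γ => if γ • D.x (D.π v) = v then D.stabAct e (D.π v) 1 (m.1 γ) else 0, by
    intro i h hh γ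
    dsimp only
    by_cases hi : i = D.π v
    · subst hi
      rw [mul_smul, D.mem_stab.1 hh]
      split_ifs
      · rw [D.stabAct_apply F, D.stabAct_apply F, one_mul, m.2 _ h hh, mul_one]
      · simp
    · split_ifs <;> simp [D.stabAct_apply_of_ne F hi]⟩
  map_add' m n := by
    ext γ
    simp only [Submodule.coe_add, Pi.add_apply, map_add]
    split_ifs <;> simp
  map_smul' c m := by
    ext γ
    simp only [Submodule.coe_smul, Pi.smul_apply, map_smul, RingHom.id_apply]
    split_ifs <;> simp

open Classical in
lemma inducedVertex_apply (F : IsPreprojFamily adjW (D.dualWeight τ) e a) {v : V} {i : I}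
    (hv : D.π v = i) (m : D.inducedSubmodule e) (γ : Γ) :
    (D.inducedVertex F v m).1 γ = if γ • D.x i = v then D.stabAct e i 1 (m.1 γ) else 0 := by
  subst hv; rfl

/-- The action of the group on the induced module. -/
def inducedAct (e : W → Module.End k N) : Γ →* Module.End k (D.inducedSubmodule e) where
  toFun δ :=
    { toFun := fun m => ⟨fun γ => m.1 (δ⁻¹ * γ), fun i h hh γ => by
        have := m.2 i h hh (δ⁻¹ * γ)
        rwa [mul_assoc] at this⟩
      map_add' := fun _ _ => rfl
      map_smul' := fun _ _ => rfl }
  map_one' := by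
    ext m γ
    simp
  map_mul' δ δ' := by
    ext m γ
    simp [mul_assoc]

lemma inducedAct_apply (δ : Γ) (m : D.inducedSubmodule e) (γ : Γ) :
    (D.inducedAct e δ m).1 γ = m.1 (δ⁻¹ * γ) := rfl

lemma fiberArrow_induced (F : IsPreprojFamily adjW (D.dualWeight τ) e a)
    (m : D.inducedSubmodule e) (i j : I) {h : Γ} (hj : h ∈ D.stab j) (γ : Γ) :
    D.fiberArrow a i j (m.1 (γ * h)) = D.fiberArrow a i j (D.stabAct e j h⁻¹ (m.1 γ)) := by
  rw [← D.fiberArrow_stabAct_apply F, m.2 j h hj]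

open Classical in
/-- A group element that maps a pair of base points to a given edge. -/
noncomputable def transEdge (v w : V) : Γ :=
  -- Off the edges the value 1 plays no role, since `inducedArrow` vanishes there.
  if h : adjV v w then ((D.adjV_iff v w).1 h).2.choose else 1

lemma transEdge_spec {v w : V} (h : adjV v w) :
    D.transEdge v w • D.x (D.π v) = v ∧ D.transEdge v w • D.x (D.π w) = w := by
  rw [transEdge, dif_pos h]
  exact ((D.adjV_iff v w).1 h).2.choose_spec

open Classical in
/-- The action of an arrow on the induced module. -/
noncomputable def inducedArrow (F : IsPreprojFamily adjW (D.dualWeight τ) e a) (v w : V) :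
    Module.End k (D.inducedSubmodule e) where
  -- The arrow acts by `fiberArrow` at a γ that carries the base edge to the given one; equivariance
  -- forces the value at the other γ over `v`.
  toFun m := ⟨fun γ => if γ • D.x (D.π v) = v ∧ adjV v w then
      D.stabAct e (D.π v) (γ⁻¹ * D.transEdge v w)
        (D.fiberArrow a (D.π v) (D.π w) (m.1 (D.transEdge v w))) else 0, by
    intro i h hh γ
    dsimp only
    by_cases hi : i = D.π v
    · subst hi
      rw [mul_smul, D.mem_stab.1 hh]
      split_ifs
      · rw [D.stabAct_apply F, D.stabAct_apply F, one_mul, mul_inv_rev, mul_assoc]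
      · simp
    · split_ifs <;> simp [D.stabAct_apply_of_ne F hi]⟩
  map_add' m n := by
    ext γ
    simp only [Submodule.coe_add, Pi.add_apply, map_add]
    split_ifs <;> simp
  map_smul' c m := by
    ext γ
    simp only [Submodule.coe_smul, Pi.smul_apply, map_smul, RingHom.id_apply]
    split_ifs <;> simp

lemma inducedArrow_of_not_adj (F : IsPreprojFamily adjW (D.dualWeight τ) e a) {v w : V}
    (h : ¬ adjV v w) : D.inducedArrow F v w = 0 := by
  ext m γ
  exact if_neg fun h' => h h'.2

lemma inducedArrow_of_ne (F : IsPreprojFamily adjW (D.dualWeight τ) e a) {v w : V}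
    {i : I} (hv : D.π v = i) (m : D.inducedSubmodule e) {γ : Γ} (h : γ • D.x i ≠ v) :
    (D.inducedArrow F v w m).1 γ = 0 := by
  subst hv
  exact if_neg fun h' => h h'.1

/-- Any δ carrying the base edge to (v, w) computes the arrow: two choices differ by an element of
the common stabilizer, which commutes with `fiberArrow`. -/
lemma inducedArrow_apply (F : IsPreprojFamily adjW (D.dualWeight τ) e a) {v w : V} {i j : I}
    {δ γ : Γ} (hv : δ • D.x i = v) (hw : δ • D.x j = w) (hγ : γ • D.x i = v)
    (m : D.inducedSubmodule e) :
    (D.inducedArrow F v w m).1 γ = D.stabAct e i (γ⁻¹ * δ) (D.fiberArrow a i j (m.1 δ)) := by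
  obtain rfl : D.π v = i := by rw [← hv, D.π_smul, D.π_x]
  obtain rfl : D.π w = j := by rw [← hw, D.π_smul, D.π_x]
  by_cases h : adjV v w
  · refine (if_pos ⟨hγ, h⟩).trans ?_
    obtain ⟨h1, h2⟩ := D.transEdge_spec h
    set δ' := D.transEdge v w
    obtain ⟨l, rfl⟩ : ∃ l, δ = δ' * l := ⟨δ'⁻¹ * δ, by group⟩
    rw [mul_smul] at hv hw
    have hl1 : l ∈ D.stab (D.π v) := D.mem_stab.2 (smul_left_cancel δ' (hv.trans h1.symm))
    have hl2 : l ∈ D.stab (D.π w) := D.mem_stab.2 (smul_left_cancel δ' (hw.trans h2.symm))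
    rw [D.fiberArrow_induced F m _ _ hl2, D.fiberArrow_stabAct_comm_apply F
      (D.inv_mem_stab.2 hl1) (D.inv_mem_stab.2 hl2), D.stabAct_apply F]
    congr 2
    group
  · rw [D.inducedArrow_of_not_adj F h, D.fiberArrow_eq_zero F]
    · simp
    · exact fun hR => h ((D.adjV_iff v w).2 ⟨hR, δ, hv, hw⟩)

lemma isSkewFamily_induced [Fintype V] [Fintype I]
    (F : IsPreprojFamily adjW (D.dualWeight τ) e a)
    (hτ : ∀ (γ : Γ) v w, τ (γ • v) (γ • w) = τ v w) :
    IsSkewFamily adjV τ (D.inducedVertex F) (D.inducedArrow F) (D.inducedAct e) where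
  mul_self v := by
    ext m γ
    rw [Module.End.mul_apply, D.inducedVertex_apply F rfl, D.inducedVertex_apply F rfl]
    split_ifs
    · rw [D.stabAct_apply F, one_mul]
    · rfl
  mul_of_ne v w hvw := by
    ext m γ
    rw [Module.End.mul_apply, D.inducedVertex_apply F rfl, D.inducedVertex_apply F rfl]
    split_ifs with h1 h2
    · refine D.stabAct_apply_of_ne F (fun h => hvw ?_) _ _ _
      rw [← h1, ← h2, h]
    · simp
    · rfl
  sum_eq_one := by
    classical
    ext m γ
    rw [LinearMap.sum_apply, Submodule.coe_sum, Finset.sum_apply]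
    have h1 : ∀ v, (D.inducedVertex F v m).1 γ =
        ∑ i, if γ • D.x i = v then D.stabAct e i 1 (m.1 γ) else 0 := by
      intro v
      rw [D.inducedVertex_apply F rfl, Finset.sum_eq_single (D.π v)]
      · intro i _ hi
        rw [if_neg]
        rintro rfl
        rw [D.π_smul, D.π_x] at hi
        exact hi rfl
      · simp
    simp only [h1]
    rw [Finset.sum_comm]
    simp only [Finset.sum_ite_eq, Finset.mem_univ, if_true]
    rw [← LinearMap.sum_apply, D.sum_stabAct_one F]
    rfl
  vertex_mul v w := by
    ext m γ
    rw [Module.End.mul_apply, D.inducedVertex_apply F rfl]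
    split_ifs with h
    · by_cases hvw : adjV v w
      · obtain ⟨h1, h2⟩ := D.transEdge_spec hvw
        rw [D.inducedArrow_apply F h1 h2 h, D.stabAct_apply F, one_mul]
      · rw [D.inducedArrow_of_not_adj F hvw]
        simp
    · rw [D.inducedArrow_of_ne F rfl m h]
  mul_vertex v w := by
    ext m γ
    rw [Module.End.mul_apply]
    by_cases hvw : adjV v w
    · obtain ⟨h1, h2⟩ := D.transEdge_spec hvw
      by_cases h : γ • D.x (D.π v) = v
      · rw [D.inducedArrow_apply F h1 h2 h, D.inducedArrow_apply F h1 h2 h,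
          D.inducedVertex_apply F rfl, if_pos h2, D.fiberArrow_stabAct_apply F]
      · rw [D.inducedArrow_of_ne F rfl _ h, D.inducedArrow_of_ne F rfl _ h]
    · rw [D.inducedArrow_of_not_adj F hvw]
      simp
  eq_zero v w h := D.inducedArrow_of_not_adj F h
  rel v := by
    ext m γ
    rw [LinearMap.sum_apply, Submodule.coe_sum, Finset.sum_apply]
    change ∑ w, τ v w • (D.inducedArrow F v w (D.inducedArrow F w v m)).1 γ = 0
    by_cases h : γ • D.x (D.π v) = v
    · set i := D.π v
      -- With `γ * l` as the element that carries the base edge to each neighbour, the relation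
      -- becomes `fiberArrow_rel` applied to `m.1 γ`.
      rw [D.sum_neighbours (fun w => τ v w • (D.inducedArrow F v w (D.inducedArrow F w v m)).1 γ)
        γ i (fun w hw => by
          rw [h] at hw
          rw [D.inducedArrow_of_not_adj F hw]; simp)]
      have h1 := LinearMap.congr_fun (D.fiberArrow_rel F i) (m.1 γ)
      rw [LinearMap.sum_apply, LinearMap.zero_apply] at h1
      rw [← h1]
      refine Finset.sum_congr rfl fun j _ => ?_
      rw [LinearMap.smul_apply, LinearMap.sum_apply, mul_comm, mul_smul]
      congr 1
      rw [Finset.smul_sum]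
      refine Finset.sum_congr rfl fun l hl => ?_
      have h2 : (γ * l) • D.x i = v := by rw [mul_smul, D.mem_stab.1 hl, h]
      have h3 : (γ * l) • D.x j = γ • l • D.x j := mul_smul _ _ _
      rw [D.inducedArrow_apply F h2 h3 h, D.inducedArrow_apply F h3 h2 h3, inv_mul_cancel_left,
        inv_mul_cancel, D.stabAct_fiberArrow_apply F, D.fiberArrow_induced F m _ _ hl, ← h3, ← h2,
        hτ]
      rfl
    · exact Finset.sum_eq_zero fun w _ => by rw [D.inducedArrow_of_ne F rfl _ h, smul_zero]
  smul_vertex δ v := by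
    ext m γ
    rw [Module.End.mul_apply, Module.End.mul_apply, D.inducedAct_apply,
      D.inducedVertex_apply F rfl, D.inducedVertex_apply F (D.π_smul δ v), D.inducedAct_apply,
      mul_smul, inv_smul_eq_iff]
  smul_arrow δ v w := by
    ext m γ
    rw [Module.End.mul_apply, Module.End.mul_apply, D.inducedAct_apply]
    by_cases hvw : adjV v w
    · obtain ⟨h1, h2⟩ := D.transEdge_spec hvw
      by_cases h : (δ⁻¹ * γ) • D.x (D.π v) = v
      · rw [D.inducedArrow_apply F h1 h2 h, D.inducedArrow_apply F (δ := δ * D.transEdge v w)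
          (by rw [mul_smul, h1]) (by rw [mul_smul, h2])
          (by rw [mul_smul, inv_smul_eq_iff] at h; exact h), D.inducedAct_apply,
          inv_mul_cancel_left]
        congr 2
        group
      · rw [D.inducedArrow_of_ne F rfl _ h, D.inducedArrow_of_ne F (D.π_smul δ v)]
        exact fun h' => h (by rw [mul_smul, inv_smul_eq_iff, h'])
    · rw [D.inducedArrow_of_not_adj F hvw, D.inducedArrow_of_not_adj F]
      · simp
      · rw [D.adjV_iff] at hvw ⊢
        rintro ⟨hR, σ, h1, h2⟩
        rw [D.π_smul] at h1 h2 hR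
        rw [D.π_smul] at hR
        exact hvw ⟨hR, δ⁻¹ * σ, by rw [mul_smul, h1, inv_smul_smul],
          by rw [mul_smul, h2, inv_smul_smul]⟩

end OrbitDuality

/-! ### The corner of the induced module, by evaluation at 1 -/

namespace OrbitDuality

variable {k : Type*} [Field k] {Γ : Type*} [Group Γ] [Fintype Γ] {V W : Type*}
  [Fintype W] [MulAction Γ V] {I : Type*} {adjV : V → V → Prop}
  {adjW : W → W → Prop} (D : OrbitDuality k Γ I adjV adjW)
  {τ : V → V → k} {N : Type*} [AddCommGroup N] [Module k N] {e : W → Module.End k N}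
  {a : W → W → Module.End k N}

/-- The value at the neutral element. -/
def evalOne (e : W → Module.End k N) : D.inducedSubmodule e →ₗ[k] N :=
  (LinearMap.proj 1).comp (D.inducedSubmodule e).subtype

lemma evalOne_apply (m : D.inducedSubmodule e) : D.evalOne e m = m.1 1 := rfl

/-- At 1, translation by a stabilizing `h` is `stabAct` by equivariance, so the character average
turns into Fourier inversion. -/
lemma evalOne_charIdem (F : IsPreprojFamily adjW (D.dualWeight τ) e a) (z : W)
    (m : D.inducedSubmodule e) :
    D.evalOne e (D.charIdem (D.inducedVertex F) (D.inducedAct e) z m) = e z (D.evalOne e m) := by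
  rw [← D.vertex_eq_sum_stabAct (e := e) (D.mem_fiber.2 rfl : z ∈ D.fiber (D.ρ z)), charIdem,
    LinearMap.smul_apply, LinearMap.smul_apply, map_smul, LinearMap.sum_apply,
    LinearMap.sum_apply, map_sum]
  congr 1
  refine Finset.sum_congr rfl fun h hh => ?_
  rw [LinearMap.smul_apply, LinearMap.smul_apply, map_smul, Module.End.mul_apply, evalOne_apply,
    D.inducedAct_apply, D.inducedVertex_apply F (D.π_x _),
    if_pos (by rw [mul_one]; exact D.mem_stab.1 (D.inv_mem_stab.2 hh)), mul_one]
  congr 1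
  have := m.2 _ h⁻¹ (D.inv_mem_stab.2 hh) 1
  rwa [one_mul, inv_inv] at this

lemma evalOne_arrow (F : IsPreprojFamily adjW (D.dualWeight τ) e a) (i j : I)
    (m : D.inducedSubmodule e) :
    D.evalOne e (D.inducedArrow F (D.x i) (D.x j) m) = D.fiberArrow a i j (D.evalOne e m) := by
  rw [evalOne_apply, D.inducedArrow_apply F (one_smul Γ _) (one_smul Γ _) (one_smul Γ _),
    inv_one, one_mul, D.stabAct_fiberArrow_apply F, evalOne_apply]

open Classical in
lemma inducedBaseIdem_apply [Fintype I] (F : IsPreprojFamily adjW (D.dualWeight τ) e a)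
    (m : D.inducedSubmodule e) (γ : Γ) :
    (D.baseIdem (D.inducedVertex F) m).1 γ =
      ∑ i, if γ • D.x i = D.x i then D.stabAct e i 1 (m.1 γ) else 0 := by
  rw [baseIdem, LinearMap.sum_apply, Submodule.coe_sum, Finset.sum_apply]
  exact Finset.sum_congr rfl fun i _ => D.inducedVertex_apply F (D.π_x i) m γ

lemma evalOne_baseIdem [Fintype I] (F : IsPreprojFamily adjW (D.dualWeight τ) e a)
    (m : D.inducedSubmodule e) :
    D.evalOne e (D.baseIdem (D.inducedVertex F) m) = D.evalOne e m := by
  rw [evalOne_apply, D.inducedBaseIdem_apply F]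
  simp only [one_smul, if_true]
  rw [← LinearMap.sum_apply, D.sum_stabAct_one F]
  rfl

/-- In the corner, the component over `i` is supported on the stabilizer of `D.x i`, where
equivariance determines it by its value at 1. -/
lemma eq_zero_of_evalOne [Fintype I] (F : IsPreprojFamily adjW (D.dualWeight τ) e a)
    (m : D.inducedSubmodule e) (hm : D.baseIdem (D.inducedVertex F) m = m)
    (h0 : D.evalOne e m = 0) : m = 0 := by
  rw [← hm]
  ext γ
  rw [D.inducedBaseIdem_apply F]
  refine Finset.sum_eq_zero fun i _ => ?_
  split_ifs with h
  · have := m.2 i γ (D.mem_stab.2 h) 1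
    rw [evalOne_apply] at h0
    rw [one_mul, h0, map_zero] at this
    exact this
  · rfl

lemma exists_evalOne [Fintype I] (F : IsPreprojFamily adjW (D.dualWeight τ) e a) (n : N) :
    ∃ m : D.inducedSubmodule e, D.baseIdem (D.inducedVertex F) m = m ∧ D.evalOne e m = n := by
  classical
  -- The only candidate: supported on the stabilizers, equivariant, and with value `n` at 1.
  let f : Γ → N := fun γ => ∑ i, if γ • D.x i = D.x i then D.stabAct e i γ⁻¹ n else 0
  have hf : ∀ i δ γ, D.stabAct e i δ (f γ) =
      if γ • D.x i = D.x i then D.stabAct e i (δ * γ⁻¹) n else 0 := by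
    intro i δ γ
    rw [map_sum, Finset.sum_eq_single i]
    · split_ifs
      · rw [D.stabAct_apply F]
      · simp
    · intro j _ hj
      split_ifs
      · rw [D.stabAct_apply_of_ne F hj.symm]
      · simp
    · simp
  refine ⟨⟨f, fun i h hh γ => ?_⟩, ?_, ?_⟩
  · rw [hf, hf, mul_smul, D.mem_stab.1 hh, one_mul, mul_inv_rev]
  · ext γ
    rw [D.inducedBaseIdem_apply F]
    refine Finset.sum_congr rfl fun i _ => ?_
    rw [hf]
    split_ifs
    · rw [one_mul]
    · rfl
  · rw [evalOne_apply]
    change f 1 = n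
    simp only [f, one_smul, if_true, inv_one]
    rw [← LinearMap.sum_apply, D.sum_stabAct_one F]
    rfl

end OrbitDuality

/-! ### The equivalence attached to an orbit duality -/

section Main

open CompatibleOrientation

variable {k : Type u} [Field k] {I₁ I₂ : Type v} [Fintype I₁] [Fintype I₂]
  {Δ₁ : SimpleGraph I₁} {Δ₂ : SimpleGraph I₂} {a₁ : Δ₁ ≃g Δ₁} {a₂ : Δ₂ ≃g Δ₂}
  (Q₁ : CompatibleOrientation Δ₁ a₁) (Q₂ : CompatibleOrientation Δ₂ a₂)

/-- Graphs in duality give equivalent categories of modules. -/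
theorem OrbitDuality.exists_equivalence [Fintype (Subgroup.zpowers a₁)] {I : Type*} [Fintype I]
    (D : OrbitDuality k (Subgroup.zpowers a₁) I Δ₁.Adj Δ₂.Adj) :
    ∃ Φ : FinDimModuleCat.{max u v} k (Q₁.skewGroupAlgebra k) ⥤
        FinDimModuleCat.{max u v} k (Q₂.preprojectiveAlgebra k),
      Φ.IsEquivalence ∧ Φ.Linear k := by
  have hne := Q₁.sign_ne_zero (k := k)
  have hanti := Q₁.sign_antisymm (k := k)
  have hτ := Q₁.sign_smul (k := k)
  have hne' := D.dualWeight_ne_zero hne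
  have hanti' := D.dualWeight_antisymm hanti
  have S := Q₁.isSkewFamily hanti hne hτ
  have hε := D.baseIdem_isIdempotentElem (A := Q₁.skewGroupAlgebra k) S
  let φ : Q₂.preprojectiveAlgebra k →ₐ[k] hε.Corner :=
    Preproj.ofFamily Q₂.asymm Q₂.adj_iff hanti' (D.cornerFamily S hτ)
  have hφv : ∀ z, φ (Preproj.vertexElt k Q₂.toDigraph z) = D.cornerVertex S z := fun z =>
    Preproj.ofFamily_vertexElt _ _ _ _ _
  have hφa : ∀ z w, φ (Preproj.arrowElt Q₂.toDigraph (D.dualWeight (Q₁.sign k)) z w) =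
      D.cornerArrow S z w := fun z w =>
    Preproj.ofFamily_arrowElt _ _ _ hne' _ _ _
  have hfaith := cornerFunctor_faithful.{_, _, _, max u v} φ _ _ (D.sum_baseIdem_eq_one S)
  have hfull := cornerFunctor_full.{_, _, _, max u v} φ _ _ (D.sum_baseIdem_eq_one S)
    (D.exists_cornerVal_eq S φ (fun T h1 h2 h3 => Q₁.mem_of_skew_generators hne h1 h2 h3)
      (fun z => ⟨_, hφv z⟩) (fun z w => ⟨_, hφa z w⟩))
  have hess : (cornerFunctor.{max u v} φ).EssSurj := by
    refine cornerFunctor_essSurj φ fun N _ _ _ ψ => ?_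
    have F := (Preproj.isPreprojFamily Q₂.asymm Q₂.adj_iff hanti' hne').map ψ
    have S' := D.isSkewFamily_induced F hτ
    let η := Q₁.ofSkewFamily hanti hne hτ S'
    have hηv := Q₁.ofSkewFamily_vertex hanti hne hτ S'
    have hηa := Q₁.ofSkewFamily_arrow hanti hne hτ S'
    have hηg := Q₁.ofSkewFamily_of hanti hne hτ S'
    have hηε : η (D.baseIdem (Q₁.skewVertex k)) = D.baseIdem (D.inducedVertex F) := by
      rw [OrbitDuality.baseIdem, map_sum]
      exact Finset.sum_congr rfl fun i _ => hηv _
    have hηp : ∀ z, η (D.charIdem (Q₁.skewVertex k) (SkewMonoidAlgebra.of _ _) z) =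
        D.charIdem (D.inducedVertex F) (D.inducedAct _) z := by
      intro z
      rw [OrbitDuality.charIdem, map_smul, map_sum, OrbitDuality.charIdem]
      congr 1
      refine Finset.sum_congr rfl fun h _ => ?_
      rw [map_smul, map_mul, hηv, hηg]
    refine ⟨D.inducedSubmodule _, inferInstance, inferInstance, inferInstance, η,
      D.evalOne _, ?_, fun m hm => D.eq_zero_of_evalOne F m (by rw [← hηε]; exact hm),
      fun n => ?_⟩
    -- The elements of Λ₂ whose actions on both sides are intertwined by evaluation form a
    -- subalgebra, so generators suffice.
    · let T : Subalgebra k (Q₂.preprojectiveAlgebra k) :=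
        { carrier := {b | ∀ m, D.evalOne _ (η (hε.cornerVal k (φ b)) m) = ψ b (D.evalOne _ m)}
          mul_mem' := fun {b c} hb hc m => by
            rw [map_mul, IsIdempotentElem.cornerVal_mul, map_mul, Module.End.mul_apply, hb, hc,
              map_mul, Module.End.mul_apply]
          add_mem' := fun {b c} hb hc m => by
            rw [map_add, map_add, map_add, LinearMap.add_apply, map_add, hb, hc, map_add,
              LinearMap.add_apply]
          algebraMap_mem' := fun c m => by
            rw [AlgHom.commutes, AlgHom.commutes, Algebra.algebraMap_eq_smul_one, map_smul,
              IsIdempotentElem.cornerVal_one, map_smul, LinearMap.smul_apply, map_smul, hηε,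
              D.evalOne_baseIdem F]
            rfl }
      intro b
      refine Preproj.adjoin_eq_top (S := T) Q₂.asymm Q₂.adj_iff hne' (fun z m => ?_)
        (fun z w m => ?_) b
      · rw [hφv]
        change D.evalOne _ (η (D.charIdem _ _ z) m) = _
        rw [hηp]
        exact D.evalOne_charIdem F z m
      · rw [hφa]
        change D.evalOne _ (η (D.charIdem _ _ z * _ * D.charIdem _ _ w) m) = _
        rw [map_mul, map_mul, hηp, hηp, hηa, Module.End.mul_apply, Module.End.mul_apply,
          D.evalOne_charIdem F, D.evalOne_arrow F, D.evalOne_charIdem F,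
          ← Module.End.mul_apply, ← Module.End.mul_apply, D.vertex_mul_fiberArrow_mul_vertex F
            (D.mem_fiber.2 rfl) (D.mem_fiber.2 rfl)]
    · obtain ⟨m, h1, h2⟩ := D.exists_evalOne F n
      exact ⟨m, by rw [hηε]; exact h1, h2⟩
  exact ⟨cornerFunctor φ, { }, inferInstance⟩

end Main

/-! ### Cartan matrices of finite type -/

section CartanMatrix

variable {I : Type*} [Fintype I] {C : Matrix I I ℤ}

open Classical in
/-- The normalized symmetric form of a Cartan matrix of finite type. -/
lemma IsDynkinCartanMatrix.exists_form (hC : IsDynkinCartanMatrix C) :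
    ∃ s : I → I → ℝ, (∀ i, s i i = 2) ∧ (∀ i j, s i j = s j i) ∧
      (∀ i j, i ≠ j → s i j ≤ 0) ∧ (∀ i j, s i j * s i j = (C i j * C j i : ℤ)) ∧
      (∀ i j, s i j = 0 ↔ C i j = 0) ∧
      ∀ y : I → ℝ, y ≠ 0 → 0 < ∑ i, ∑ j, s i j * (y i * y j) := by
  obtain ⟨d, hd, hpos⟩ := hC.posDef
  have hsym : ∀ i j, d i * (C i j : ℝ) = d j * (C j i : ℝ) := by
    intro i j
    have := hpos.isHermitian.apply j i
    simpa using this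
  have hsq : ∀ i, √(d i) * √(d i) = d i := fun i => Real.mul_self_sqrt (hd i).le
  have hs0 : ∀ i, √(d i) ≠ 0 := fun i => (Real.sqrt_pos.2 (hd i)).ne'
  have key : ∀ i j, d i * (C i j : ℝ) / (√(d i) * √(d j)) =
      d j * (C j i : ℝ) / (√(d j) * √(d i)) := fun i j => by
    rw [hsym, mul_comm √(d i)]
  -- Conjugating `C` by the diagonal matrix of the √(d i) makes it symmetric with diagonal 2;
  -- positivity is transported by the substitution y i / √(d i).
  refine ⟨fun i j => d i * C i j / (√(d i) * √(d j)), fun i => ?_, key, fun i j hij => ?_,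
    fun i j => ?_, fun i j => ?_, fun y hy => ?_⟩
  · beta_reduce
    rw [hsq, hC.diag]
    field_simp [(hd i).ne']
    norm_num
  · refine div_nonpos_of_nonpos_of_nonneg (mul_nonpos_of_nonneg_of_nonpos (hd i).le ?_)
      (by positivity)
    exact_mod_cast hC.offDiag i j hij
  · beta_reduce
    nth_rewrite 2 [key]
    rw [div_mul_div_comm, div_eq_iff (by simp [hs0])]
    push_cast
    calc _ = (C i j * C j i : ℝ) * (d i * d j) := by ring
      _ = (C i j * C j i : ℝ) * ((√(d i) * √(d i)) * (√(d j) * √(d j))) := by rw [hsq, hsq]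
      _ = _ := by ring
  · simp [hs0, (hd i).ne']
  · have hz : (fun i => y i / √(d i)) ≠ 0 := by
      intro h
      apply hy
      funext i
      have := congrFun h i
      simpa [hs0] using this
    have := hpos.dotProduct_mulVec_pos hz
    simp only [dotProduct, Matrix.mulVec, Matrix.of_apply, Finset.mul_sum] at this
    refine this.trans_eq (Finset.sum_congr rfl fun i _ => Finset.sum_congr rfl fun j _ => ?_)
    rw [Pi.star_apply, star_trivial]
    have := hs0 i
    have := hs0 j
    field_simp

/-- Positivity of the normalized form on the indicator vector of {i, j} gives 4 + 2 s i j > 0, hence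
(s i j)² < 4. -/
lemma IsDynkinCartanMatrix.mul_lt_four (hC : IsDynkinCartanMatrix C) {i j : I} (hij : i ≠ j) :
    C i j * C j i < 4 := by
  classical
  obtain ⟨s, h2, hsym, hle, hsq, -, hpos⟩ := hC.exists_form
  have h := hpos (fun l => if l = i ∨ l = j then 1 else 0) (fun h => by
    have := congrFun h i
    simp at this)
  have h1 : ∑ l, ∑ l', s l l' * ((if l = i ∨ l = j then 1 else 0) *
      (if l' = i ∨ l' = j then 1 else 0)) = s i i + s i j + (s j i + s j j) := by
    have h3 : ∀ f : I → ℝ, ∑ l, f l * (if l = i ∨ l = j then 1 else 0) = f i + f j := by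
      intro f
      rw [← Finset.sum_pair hij, ← Finset.sum_subset (Finset.subset_univ ({i, j} : Finset I))]
      · exact Finset.sum_congr rfl fun l hl => by
          rw [if_pos (by simpa using hl), mul_one]
      · intro l _ hl
        rw [if_neg (by simpa using hl), mul_zero]
    have h4 : ∀ l, ∑ l', s l l' * ((if l = i ∨ l = j then 1 else 0) *
        (if l' = i ∨ l' = j then 1 else 0)) =
        (s l i + s l j) * (if l = i ∨ l = j then 1 else 0) := fun l => by
      rw [← h3, Finset.sum_mul]
      exact Finset.sum_congr rfl fun l' _ => by ring
    rw [Finset.sum_congr rfl fun l _ => h4 l, h3]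
  rw [h1, h2, h2, hsym j i] at h
  have h4 : s i j * s i j < 4 := by nlinarith [hle i j hij]
  rw [hsq] at h4
  exact_mod_cast h4

lemma IsDynkinCartanMatrix.symm_zero (hC : IsDynkinCartanMatrix C) {i j : I} :
    C i j = 0 ↔ C j i = 0 := by
  obtain ⟨s, -, hsym, -, -, h0, -⟩ := hC.exists_form
  rw [← h0, hsym, h0]

/-- The graph of a Cartan matrix. -/
def cartanGraph (C : Matrix I I ℤ) : SimpleGraph I := SimpleGraph.fromRel fun i j => C i j ≠ 0

lemma IsDynkinCartanMatrix.adj_iff (hC : IsDynkinCartanMatrix C) {i j : I} :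
    (cartanGraph C).Adj i j ↔ i ≠ j ∧ C i j ≠ 0 := by
  rw [cartanGraph, SimpleGraph.fromRel_adj, Ne, Ne, Ne, hC.symm_zero (i := j), or_self]

lemma IsDynkinCartanMatrix.entry_le (hC : IsDynkinCartanMatrix C) {i j : I}
    (h : (cartanGraph C).Adj i j) : C i j ≤ -1 := by
  have h1 := hC.offDiag i j (hC.adj_iff.1 h).1
  have h2 := (hC.adj_iff.1 h).2
  omega

/-- One of two opposite entries is `-1`. -/
lemma IsDynkinCartanMatrix.entry_eq_neg_one (hC : IsDynkinCartanMatrix C) {i j : I}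
    (h : (cartanGraph C).Adj i j) : C i j = -1 ∨ C j i = -1 := by
  have h1 := hC.entry_le h
  have h2 := hC.entry_le h.symm
  have h3 := hC.mul_lt_four (hC.adj_iff.1 h).1
  by_contra! h4
  have h5 : C i j ≤ -2 := by omega
  have h6 : C j i ≤ -2 := by omega
  nlinarith

/-- The graph of a Cartan matrix of finite type is a tree. -/
lemma IsDynkinCartanMatrix.isTree (hC : IsDynkinCartanMatrix C) : (cartanGraph C).IsTree := by
  classical
  have hconn : (cartanGraph C).Connected := hC.connected
  have := hconn.nonempty
  rw [SimpleGraph.isTree_iff_connected_and_card]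
  refine ⟨hconn, le_antisymm ?_ hconn.card_vert_le_card_edgeSet_add_one⟩
  obtain ⟨s, h2, hsym, hle, hsq, h0, hpos⟩ := hC.exists_form
  -- On the all-ones vector the form is at most 2|I| - 2|E|, since `s i j ≤ -1` on edges. Positivity
  -- gives |E| < |I|, and a connected graph with so few edges is a tree.
  have h := hpos (fun _ => 1) (fun h => by
    have := congrFun h (Classical.arbitrary I)
    simp at this)
  simp only [mul_one] at h
  have h1 : ∀ i, ∑ j, s i j ≤ 2 - ((cartanGraph C).degree i : ℝ) := by
    intro i
    have h3 : ∀ j, s i j ≤ (if j = i then 2 else 0) -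
        (if (cartanGraph C).Adj i j then 1 else 0) := by
      intro j
      by_cases hij : j = i
      · subst hij
        simp [h2]
      · by_cases hadj : (cartanGraph C).Adj i j
        · rw [if_neg hij, if_pos hadj]
          have h4 : (1 : ℝ) ≤ s i j * s i j := by
            rw [hsq]
            have := hC.entry_le hadj
            have := hC.entry_le hadj.symm
            have h5 : 1 ≤ C i j * C j i := by nlinarith
            exact_mod_cast h5
          nlinarith [hle i j (Ne.symm hij)]
        · rw [if_neg hij, if_neg hadj]
          simpa using hle i j (Ne.symm hij)
    refine (Finset.sum_le_sum fun j _ => h3 j).trans ?_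
    rw [Finset.sum_sub_distrib, Finset.sum_ite_eq', if_pos (Finset.mem_univ _), Finset.sum_boole,
      ← SimpleGraph.card_neighborFinset_eq_degree, SimpleGraph.neighborFinset_eq_filter]
  have h5 := h.trans_le (Finset.sum_le_sum fun i _ => h1 i)
  have h6 := (cartanGraph C).sum_degrees_eq_twice_card_edges
  have h7 : (∑ i, ((cartanGraph C).degree i : ℝ)) = 2 * ((cartanGraph C).edgeFinset.card : ℝ) := by
    exact_mod_cast h6
  rw [Finset.sum_sub_distrib, h7, Finset.sum_const, Finset.card_univ, nsmul_eq_mul] at h5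
  have h8 : (cartanGraph C).edgeFinset.card < Fintype.card I := by
    have : ((cartanGraph C).edgeFinset.card : ℝ) < Fintype.card I := by linarith
    exact_mod_cast this
  rw [Nat.card_eq_fintype_card, Nat.card_eq_fintype_card, ← SimpleGraph.edgeFinset_card]
  exact h8

end CartanMatrix

/-! ### Lifting trees -/

namespace SimpleGraph

section Lifting

variable {I V : Type*} {G : SimpleGraph I} (next : V → I → V)

/-- The end point of the lift of a walk, for given lifts of the edges. -/
def Walk.liftEnd (v : V) : {i j : I} → G.Walk i j → V
  | _, _, .nil => v
  | _, _, .cons (v := l) _ p => Walk.liftEnd (next v l) p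

lemma Walk.liftEnd_concat (v : V) {i j l : I} (p : G.Walk i j) (h : G.Adj j l) :
    (p.concat h).liftEnd next v = next (p.liftEnd next v) l := by
  induction p generalizing v with
  | nil => rfl
  | cons h' p ih => exact ih _ h

/-- A tree lifts along a map with the lifting property for edges. -/
lemma IsTree.exists_section (hG : G.IsTree) {Δ : SimpleGraph V} (π : V → I)
    (hπ : Function.Surjective π)
    (hlift : ∀ v j, G.Adj (π v) j → ∃ w, π w = j ∧ Δ.Adj v w) :
    ∃ s : I → V, (∀ i, π (s i) = i) ∧ ∀ i j, G.Adj i j → Δ.Adj (s i) (s j) := by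
  classical
  obtain ⟨r⟩ := hG.1.nonempty
  obtain ⟨v₀, hv₀⟩ := hπ r
  let next : V → I → V := fun v j => if h : G.Adj (π v) j then (hlift v j h).choose else v
  have hnext : ∀ v j, G.Adj (π v) j → π (next v j) = j ∧ Δ.Adj v (next v j) := by
    intro v j h
    simp only [next, dif_pos h]
    exact (hlift v j h).choose_spec
  have hend : ∀ {i j : I} (p : G.Walk i j) (v : V), π v = i → π (p.liftEnd next v) = j := by
    intro i j p
    induction p with
    | nil => exact fun v hv => hv
    | cons h p ih => exact fun v hv => ih _ (hnext _ _ (by rwa [hv])).1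
  choose p hp hp' using fun i => hG.existsUnique_path r i
  -- Each vertex is lifted along the path from the root. For adjacent vertices, one of the two paths
  -- is the other one extended by the edge.
  have key : ∀ i j, G.Adj i j → i ∈ (p j).support →
      Δ.Adj ((p i).liftEnd next v₀) ((p j).liftEnd next v₀) := by
    intro i j hij hi
    rw [hG.2.path_concat (hp i) (hp j) hij hi, Walk.liftEnd_concat]
    exact (hnext _ _ (by rwa [hend (p i) v₀ hv₀])).2
  refine ⟨fun i => (p i).liftEnd next v₀, fun i => hend _ _ hv₀, fun i j hij => ?_⟩
  by_cases hi : i ∈ (p j).support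
  · exact key i j hij hi
  · exact (key j i hij.symm
      (hG.2.mem_support_of_ne_mem_support_of_adj_of_isPath (hp i) (hp j) hij hi)).symm

end Lifting

end SimpleGraph

/-! ### Foldings as maps of graphs -/

/-- A map `π` from the vertices of `Δ` to a set with a graph `G` identifies this set with the set
of orbits of `a`; there is an edge between two orbits precisely if they are adjacent in `G`, and
then a vertex over `i` has `c i j` neighbours over `j`. -/
structure SimpleGraph.IsFolding {V I : Type*} {Δ : SimpleGraph V} (a : Δ ≃g Δ) (G : SimpleGraph I)
    (c : I → I → ℕ) (π : V → I) : Prop where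
  surjective : Function.Surjective π
  eq_iff : ∀ v w, π v = π w ↔ ∃ m : ℤ, a ^ m • v = w
  ncard_adj : ∀ v j, G.Adj (π v) j → {w | π w = j ∧ Δ.Adj v w}.ncard = c (π v) j
  adj : ∀ v w, Δ.Adj v w → G.Adj (π v) (π w)
  pos : ∀ i j, G.Adj i j → 0 < c i j
  eq_one : ∀ i j, G.Adj i j → c i j = 1 ∨ c j i = 1
  card_mul : ∀ i j, (π ⁻¹' {i}).ncard * c i j = (π ⁻¹' {j}).ncard * c j i

namespace SimpleGraph

lemma smul_adj_smul {V : Type*} {Δ : SimpleGraph V} (g : Δ ≃g Δ) {v w : V} :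
    Δ.Adj (g • v) (g • w) ↔ Δ.Adj v w := g.map_rel_iff

namespace IsFolding

variable {V I : Type*} {Δ : SimpleGraph V} {a : Δ ≃g Δ} {G : SimpleGraph I}
  {c : I → I → ℕ} {π : V → I} (F : IsFolding a G c π)

include F

lemma exists_adj (v : V) (j : I) (h : G.Adj (π v) j) : ∃ w, π w = j ∧ Δ.Adj v w := by
  have h1 := F.pos _ _ h
  rw [← F.ncard_adj v j h] at h1
  exact Set.nonempty_of_ncard_ne_zero h1.ne'

lemma apply_smul (m : ℤ) (v : V) : π (a ^ m • v) = π v := ((F.eq_iff _ _).2 ⟨m, rfl⟩).symm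

lemma orbit_eq (v : V) : MulAction.orbit (Subgroup.zpowers a) v = π ⁻¹' {π v} := by
  ext w
  rw [Set.mem_preimage, Set.mem_singleton_iff, eq_comm, F.eq_iff]
  constructor
  · rintro ⟨⟨_, m, rfl⟩, rfl⟩
    exact ⟨m, rfl⟩
  · rintro ⟨m, rfl⟩
    exact ⟨⟨a ^ m, m, rfl⟩, rfl⟩

lemma dvd_or_dvd (i j : I) (h : G.Adj i j) :
    (π ⁻¹' {i}).ncard ∣ (π ⁻¹' {j}).ncard ∨ (π ⁻¹' {j}).ncard ∣ (π ⁻¹' {i}).ncard := by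
  have := F.card_mul i j
  rcases F.eq_one i j h with h1 | h1
  · right
    rw [h1, mul_one] at this
    exact ⟨_, this⟩
  · left
    rw [h1, mul_one] at this
    exact ⟨_, this.symm⟩

lemma exists_zpow_smul {s : I → V} (hs : ∀ i, π (s i) = i) (v : V) :
    ∃ m : ℤ, a ^ m • s (π v) = v := (F.eq_iff _ _).1 (hs _)

/-- Each edge is a translate of an edge between base points. -/
lemma exists_zpow_smul_of_adj {s : I → V} (hs : ∀ i, π (s i) = i)
    (hs' : ∀ i j, G.Adj i j → Δ.Adj (s i) (s j)) {v w : V} (h : Δ.Adj v w) :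
    ∃ m : ℤ, a ^ m • s (π v) = v ∧ a ^ m • s (π w) = w := by
  -- If `v` has a single neighbour over `π w`, the translate of the lifted edge that starts at `v`
  -- must end at `w`.
  have key : ∀ v w, Δ.Adj v w → c (π v) (π w) = 1 →
      ∃ m : ℤ, a ^ m • s (π v) = v ∧ a ^ m • s (π w) = w := by
    intro v w h h1
    obtain ⟨m, hm⟩ := F.exists_zpow_smul hs v
    refine ⟨m, hm, ?_⟩
    have hG := F.adj _ _ h
    obtain ⟨u, hu⟩ := Set.ncard_eq_one.1 ((F.ncard_adj v _ hG).trans h1)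
    have h2 : ∀ u', π u' = π w → Δ.Adj v u' → u' = u := fun u' h3 h4 => by
      have : u' ∈ ({u} : Set V) := hu ▸ ⟨h3, h4⟩
      exact this
    refine (h2 _ (by rw [F.apply_smul, hs]) ?_).trans (h2 w rfl h).symm
    nth_rewrite 1 [← hm]
    exact (smul_adj_smul _).2 (hs' _ _ hG)
  rcases F.eq_one _ _ (F.adj _ _ h) with h1 | h1
  · exact key v w h h1
  · obtain ⟨m, hm, hm'⟩ := key w v h.symm h1
    exact ⟨m, hm', hm⟩

variable [Finite V]

lemma ncard_pos (i : I) : 0 < (π ⁻¹' {i}).ncard := by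
  obtain ⟨v, rfl⟩ := F.surjective i
  exact (Set.ncard_pos (Set.toFinite _)).2 ⟨v, rfl⟩

lemma zpow_smul_eq_iff (m : ℤ) (v : V) : a ^ m • v = v ↔ ((π ⁻¹' {π v}).ncard : ℤ) ∣ m := by
  classical
  have := Fintype.ofFinite (MulAction.orbit (Subgroup.zpowers a) v)
  rw [MulAction.zpow_smul_eq_iff_minimalPeriod_dvd, MulAction.minimalPeriod_eq_card,
    ← F.orbit_eq, Set.ncard_eq_toFinset_card', Set.toFinset_card]

lemma zpow_smul_eq_zpow_smul_iff (m l : ℤ) (v : V) :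
    a ^ m • v = a ^ l • v ↔ ((π ⁻¹' {π v}).ncard : ℤ) ∣ m - l := by
  rw [← F.zpow_smul_eq_iff, sub_eq_neg_add, zpow_add, mul_smul, zpow_neg, inv_smul_eq_iff]

/-- The orbit lengths on a connected graph have no common divisor. -/
lemma isUnit_of_dvd_ncard {s : I → V} (hs : ∀ i, π (s i) = i)
    (hs' : ∀ i j, G.Adj i j → Δ.Adj (s i) (s j)) (hΔ : Δ.Connected) {q : ℤ}
    (hq : ∀ i, q ∣ (π ⁻¹' {i}).ncard) :
    IsUnit q := by
  -- Modulo `q`, the exponent `t` depends only on the vertex and is constant along edges, hence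
  -- constant on the connected graph; but applying `a` raises it by 1.
  choose t ht using F.exists_zpow_smul hs
  have hdvd : ∀ v (m : ℤ), a ^ m • s (π v) = v → q ∣ t v - m := fun v m hm => by
    have := (F.zpow_smul_eq_zpow_smul_iff (t v) m (s (π v))).1 ((ht v).trans hm.symm)
    exact (hq _).trans this
  have hadj : ∀ v w, Δ.Adj v w → q ∣ t v - t w := fun v w h => by
    obtain ⟨m, hv, hw⟩ := F.exists_zpow_smul_of_adj hs hs' h
    simpa using dvd_sub (hdvd v m hv) (hdvd w m hw)
  have hwalk : ∀ v w, Δ.Walk v w → q ∣ t v - t w := fun v w p => by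
    induction p with
    | nil => simp
    | cons h p ih => simpa using dvd_add (hadj _ _ h) ih
  obtain ⟨v⟩ := hΔ.nonempty
  obtain ⟨p⟩ := hΔ.preconnected v (a ^ (1 : ℤ) • v)
  have h1 := hdvd (a ^ (1 : ℤ) • v) (1 + t v) (by
    rw [F.apply_smul, zpow_add, mul_smul, ht])
  have h2 := dvd_add h1 (hwalk _ _ p)
  rw [isUnit_iff_dvd_one]
  have h3 : t (a ^ (1 : ℤ) • v) - (1 + t v) + (t v - t (a ^ (1 : ℤ) • v)) = -1 := by ring
  rw [h3] at h2
  exact (dvd_neg.1 h2)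

end IsFolding

/-! ### From dual foldings to an orbit duality -/

section Duality

variable {V W I : Type*} [Finite V] [Fintype W] {Δ : SimpleGraph V} {Δ' : SimpleGraph W}
  {a : Δ ≃g Δ} {b : Δ' ≃g Δ'} {G : SimpleGraph I} {c : I → I → ℕ} {π : V → I} {ρ : W → I}

/-- Orbit lengths of dual foldings are complementary divisors of the order of the first
automorphism. -/
lemma IsFolding.ncard_mul_ncard (F : IsFolding a G c π) (F' : IsFolding b G (fun i j => c j i) ρ)
    (hG : G.Connected) (hΔ' : Δ'.Connected) {x : I → V} (hx : ∀ i, π (x i) = i)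
    {y : I → W} (hy : ∀ i, ρ (y i) = i) (hy' : ∀ i j, G.Adj i j → Δ'.Adj (y i) (y j)) (i : I) :
    (π ⁻¹' {i}).ncard * (ρ ⁻¹' {i}).ncard = orderOf a := by
  have hadj : ∀ i j, G.Adj i j → (π ⁻¹' {i}).ncard * (ρ ⁻¹' {i}).ncard =
      (π ⁻¹' {j}).ncard * (ρ ⁻¹' {j}).ncard := fun i j h => by
    have h1 := F.card_mul i j
    have h2 := F'.card_mul i j
    refine Nat.eq_of_mul_eq_mul_right (Nat.mul_pos (F.pos _ _ h) (F.pos _ _ h.symm)) ?_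
    calc _ = ((π ⁻¹' {i}).ncard * c i j) * ((ρ ⁻¹' {i}).ncard * c j i) := by ring
      _ = _ := by rw [h1, h2]; ring
  have hwalk : ∀ i j, G.Walk i j → (π ⁻¹' {i}).ncard * (ρ ⁻¹' {i}).ncard =
      (π ⁻¹' {j}).ncard * (ρ ⁻¹' {j}).ncard := fun i j p => by
    induction p with
    | nil => rfl
    | cons h p ih => exact (hadj _ _ h).trans ih
  have hconst : ∀ j, (π ⁻¹' {j}).ncard * (ρ ⁻¹' {j}).ncard =
      (π ⁻¹' {i}).ncard * (ρ ⁻¹' {i}).ncard := fun j =>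
    (hG.preconnected j i).elim fun p => hwalk j i p
  set N := (π ⁻¹' {i}).ncard * (ρ ⁻¹' {i}).ncard with hN
  have hNpos : 0 < N := Nat.mul_pos (F.ncard_pos i) (F'.ncard_pos i)
  refine Nat.dvd_antisymm ?_ ?_
  · have hdvd : ∀ j, (π ⁻¹' {j}).ncard ∣ orderOf a := fun j => by
      have := (F.zpow_smul_eq_iff (orderOf a) (x j)).1 (by
        rw [zpow_natCast, pow_orderOf_eq_one, one_smul])
      rw [hx] at this
      exact_mod_cast this
    have hg : 0 < N.gcd (orderOf a) := Nat.gcd_pos_of_pos_left _ hNpos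
    -- As `N` divides `orderOf a` times each orbit length of `b`, the part of `N` prime to the
    -- cofactor of `orderOf a` divides all these lengths, whose common divisors are units.
    have hunit : IsUnit ((N / N.gcd (orderOf a) : ℕ) : ℤ) := by
      refine F'.isUnit_of_dvd_ncard hy hy' hΔ' fun j => ?_
      rw [Int.natCast_dvd_natCast]
      refine (Nat.coprime_div_gcd_div_gcd hg).dvd_of_dvd_mul_left ?_
      refine Nat.dvd_of_mul_dvd_mul_left hg ?_
      rw [Nat.mul_div_cancel' (Nat.gcd_dvd_left _ _), ← mul_assoc,
        Nat.mul_div_cancel' (Nat.gcd_dvd_right _ _), ← hconst j]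
      exact Nat.mul_dvd_mul_right (hdvd j) _
    have h1 : N / N.gcd (orderOf a) = 1 := by
      rwa [Int.isUnit_iff_natAbs_eq, Int.natAbs_natCast] at hunit
    have h2 := Nat.mul_div_cancel' (Nat.gcd_dvd_left N (orderOf a))
    rw [h1, mul_one] at h2
    rw [← h2]
    exact Nat.gcd_dvd_right _ _
  · refine orderOf_dvd_of_pow_eq_one (RelIso.ext fun v => ?_)
    have := (F.zpow_smul_eq_iff N v).2 (by
      rw [← hconst (π v)]
      exact_mod_cast Nat.dvd_mul_right _ _)
    rwa [zpow_natCast] at this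

/-- Dual foldings give rise to an orbit duality. -/
lemma IsFolding.nonempty_orbitDuality {k : Type*} [Field k] [IsAlgClosed k]
    [Fintype (Subgroup.zpowers a)]
    (F : IsFolding a G c π) (F' : IsFolding b G (fun i j => c j i) ρ)
    (hG : G.IsTree) (hΔ' : Δ'.Connected) (hn : (orderOf a : k) ≠ 0) :
    Nonempty (OrbitDuality k (Subgroup.zpowers a) I Δ.Adj Δ'.Adj) := by
  obtain ⟨x, hx, hx'⟩ := hG.exists_section π F.surjective F.exists_adj
  obtain ⟨y, hy, hy'⟩ := hG.exists_section ρ F'.surjective F'.exists_adj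
  have hcard := F.ncard_mul_ncard F' hG.1 hΔ' hx hy hy'
  choose t ht using F'.exists_zpow_smul hy
  have : NeZero (orderOf a : k) := ⟨hn⟩
  have hn0 : orderOf a ≠ 0 := fun h => hn (by rw [h, Nat.cast_zero])
  obtain ⟨ζ₀, hζ₀⟩ := HasEnoughRootsOfUnity.exists_primitiveRoot k (orderOf a)
  obtain ⟨ζ, hζ⟩ : ∃ ζ : kˣ, IsPrimitiveRoot ζ (orderOf a) := ⟨_, hζ₀.isUnit_unit hn0⟩
  let g : Subgroup.zpowers a := ⟨a, Subgroup.mem_zpowers a⟩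
  have hg : ∀ h, h ∈ Subgroup.zpowers g := fun ⟨_, m, hm⟩ => ⟨m, Subtype.ext hm⟩
  have hg' : orderOf ζ ∣ orderOf g := by
    rw [← hζ.eq_orderOf, ← Subgroup.orderOf_coe]
  let χ₁ : Subgroup.zpowers a →* kˣ := monoidHomOfForallMemZpowers hg hg'
  have hχ₁ : ∀ m : ℤ, χ₁ (g ^ m) = ζ ^ m := fun m => by
    rw [map_zpow, monoidHomOfForallMemZpowers_apply_gen]
  have hex : ∀ h : Subgroup.zpowers a, ∃ m : ℤ, g ^ m = h := hg
  have hsmul : ∀ (m : ℤ) (v : V), g ^ m • v = a ^ m • v := fun m v => by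
    rw [Subgroup.smul_def, Subgroup.coe_zpow]
  have hstab : ∀ (m : ℤ) i, g ^ m • x i = x i ↔ ((π ⁻¹' {i}).ncard : ℤ) ∣ m := fun m i => by
    rw [hsmul, F.zpow_smul_eq_iff, hx]
  have hcardZ : ∀ i, ((π ⁻¹' {i}).ncard : ℤ) * ((ρ ⁻¹' {i}).ncard : ℤ) = orderOf a :=
    fun i => by exact_mod_cast hcard i
  have hmul : ∀ i (l l' : ℤ), ((π ⁻¹' {i}).ncard : ℤ) ∣ l → ((ρ ⁻¹' {i}).ncard : ℤ) ∣ l' →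
      (orderOf a : ℤ) ∣ l * l' := fun i l l' h h' => by
    rw [← hcardZ i]
    exact mul_dvd_mul h h'
  have hdvd : ∀ i (l' : ℤ), (orderOf a : ℤ) ∣ (π ⁻¹' {i}).ncard * l' →
      ((ρ ⁻¹' {i}).ncard : ℤ) ∣ l' := fun i l' h => by
    rw [← hcardZ i] at h
    exact Int.dvd_of_mul_dvd_mul_left (by exact_mod_cast (F.ncard_pos i).ne') h
  -- On the stabilizer of `x (ρ z)`, only the class of `t z` modulo the length of the orbit of `z`
  -- matters. The values off the stabilizer depend on the choice of `t` but are never tested.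
  let χ : W → Subgroup.zpowers a →* kˣ := fun z => (zpowGroupHom (t z)).comp χ₁
  have hχ : ∀ z (m : ℤ), χ z (g ^ m) = ζ ^ (m * t z) := fun z m => by
    change χ₁ (g ^ m) ^ t z = _
    rw [hχ₁, zpow_mul]
  have hχ_eq : ∀ z w (m : ℤ), χ z (g ^ m) = χ w (g ^ m) ↔
      (orderOf a : ℤ) ∣ m * (t z - t w) := fun z w m => by
    rw [hχ, hχ, ← hζ.zpow_eq_one_iff_dvd, mul_sub, zpow_sub, mul_inv_eq_one]
  have ht' : ∀ z (m : ℤ), b ^ m • y (ρ z) = z → ((ρ ⁻¹' {ρ z}).ncard : ℤ) ∣ t z - m :=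
    fun z m h => by
      have := (F'.zpow_smul_eq_zpow_smul_iff (t z) m (y (ρ z))).1 ((ht z).trans h.symm)
      rwa [hy] at this
  have ht'' : ∀ z (m : ℤ), ((ρ ⁻¹' {ρ z}).ncard : ℤ) ∣ t z - m → b ^ m • y (ρ z) = z :=
    fun z m h => by
      rw [← (F'.zpow_smul_eq_zpow_smul_iff (t z) m (y (ρ z))).2 (by rwa [hy]), ht]
  refine ⟨{
    R := G.Adj
    π := π
    x := x
    ρ := ρ
    χ := χ
    π_x := hx
    π_smul := fun γ v => ?_
    exists_smul := fun v => ?_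
    adjV_iff := fun v w => ?_
    adjW_iff := fun z w => ?_
    orthogonality := fun z w hzw hne => ?_
    sum_character := fun i h hi hne => ?_
    card_fiber := fun i => ?_
    card_ne := by rwa [Nat.card_zpowers] }⟩
  · obtain ⟨m, rfl⟩ := hex γ
    exact F.apply_smul m v
  · obtain ⟨m, hm⟩ := F.exists_zpow_smul hx v
    exact ⟨g ^ m, hm⟩
  · constructor
    · intro h
      obtain ⟨m, hm⟩ := F.exists_zpow_smul_of_adj hx hx' h
      exact ⟨F.adj _ _ h, g ^ m, hm⟩
    · rintro ⟨h, γ, hv, hw⟩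
      obtain ⟨m, rfl⟩ := hex γ
      rw [← hv, ← hw]
      exact (smul_adj_smul (a ^ m)).2 (hx' _ _ h)
  · constructor
    · intro h
      obtain ⟨l, hz, hw⟩ := F'.exists_zpow_smul_of_adj hy hy' h
      refine ⟨F'.adj _ _ h, fun γ h1 h2 => ?_⟩
      obtain ⟨m, rfl⟩ := hex γ
      rw [hχ_eq]
      have := dvd_sub (hmul _ _ _ ((hstab _ _).1 h1) (ht' z l hz))
        (hmul _ _ _ ((hstab _ _).1 h2) (ht' w l hw))
      rwa [← mul_sub, sub_sub_sub_cancel_right] at this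
    · rintro ⟨h, hh⟩
      -- One stabilizer contains the other, so agreement at a generator of the smaller one puts `z`
      -- and `w` on a common translate of the lifted edge.
      rcases F.dvd_or_dvd _ _ h with hd | hd
      · have h1 := hh (g ^ ((π ⁻¹' {ρ w}).ncard : ℤ))
          ((hstab _ _).2 (Int.natCast_dvd_natCast.2 hd)) ((hstab _ _).2 dvd_rfl)
        rw [hχ_eq] at h1
        have h2 := ht'' w (t z) ((dvd_sub_comm).1 (hdvd _ _ h1))
        have h3 := (smul_adj_smul (b ^ t z)).2 (hy' _ _ h)
        rwa [ht z, h2] at h3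
      · have h1 := hh (g ^ ((π ⁻¹' {ρ z}).ncard : ℤ))
          ((hstab _ _).2 dvd_rfl) ((hstab _ _).2 (Int.natCast_dvd_natCast.2 hd))
        rw [hχ_eq] at h1
        have h2 := ht'' z (t w) (hdvd _ _ h1)
        have h3 := (smul_adj_smul (b ^ t w)).2 (hy' _ _ h)
        rwa [ht w, h2] at h3
  · by_contra! hcon
    have h1 := hcon (g ^ ((π ⁻¹' {ρ z}).ncard : ℤ)) ((hstab _ _).2 dvd_rfl)
    rw [hχ_eq] at h1
    have h2 := ht'' z (t w) (hdvd _ _ h1)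
    rw [hzw, ht w] at h2
    exact hne h2.symm
  · obtain ⟨m, rfl⟩ := hex h
    have hζm : ((ζ ^ m : kˣ) : k) ≠ 1 := fun h1 => by
      have h2 := (hζ.zpow_eq_one_iff_dvd m).1 (Units.ext h1)
      apply hne
      refine Subtype.ext ?_
      change a ^ m = 1
      exact orderOf_dvd_iff_zpow_eq_one.1 h2
    -- Applying `b` permutes the fiber and multiplies the character values at `g ^ m` by ζ^m ≠ 1, so
    -- their sum is zero.
    have hbij : Set.BijOn (fun z => b • z) {z | ρ z = i} {z | ρ z = i} := by
      have h1 : ∀ z, ρ (b • z) = ρ z := fun z => by simpa using F'.apply_smul 1 z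
      refine ⟨fun z hz => (h1 z).trans hz, (MulAction.injective b).injOn, fun z hz => ?_⟩
      refine ⟨b⁻¹ • z, ?_, smul_inv_smul _ _⟩
      change ρ _ = i
      rw [← h1, smul_inv_smul]
      exact hz
    have hsum := finsum_mem_eq_of_bijOn (f := fun z => (ζ ^ m : kˣ) * ((χ z (g ^ m) : kˣ) : k))
      (g := fun z => ((χ z (g ^ m) : kˣ) : k)) _ hbij fun z hz => by
        rw [← Units.val_mul, hχ, hχ, ← zpow_add]
        congr 1
        rw [← mul_inv_eq_one, ← zpow_sub, hζ.zpow_eq_one_iff_dvd]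
        have h1 := ht' (b • z) (1 + t z) (by
          have : ρ (b • z) = ρ z := by simpa using F'.apply_smul 1 z
          rw [this, zpow_add, mul_smul, ht, zpow_one])
        have h2 : ρ (b • z) = i := hbij.1 hz
        rw [h2] at h1
        have h3 := hmul _ _ _ ((hstab _ _).1 hi) ((dvd_sub_comm).1 h1)
        have h4 : m + m * t z - m * t (b • z) = m * (1 + t z - t (b • z)) := by ring
        rwa [h4]
    rw [← mul_finsum_mem] at hsum
    have : (((ζ ^ m : kˣ) : k) - 1) * ∑ᶠ z ∈ {z | ρ z = i}, ((χ z (g ^ m) : kˣ) : k) = 0 := by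
      rw [sub_mul, one_mul, hsum, sub_self]
    exact (mul_eq_zero.1 this).resolve_left (sub_ne_zero.2 hζm)
  · have h1 := Subgroup.card_mul_index (MulAction.stabilizer (Subgroup.zpowers a) (x i))
    rw [MulAction.index_stabilizer, F.orbit_eq, hx, Nat.card_zpowers, ← hcard i, mul_comm] at h1
    exact (Nat.eq_of_mul_eq_mul_left (F.ncard_pos i) h1).symm

end Duality

end SimpleGraph

/-! ### Folded Cartan matrices as foldings -/

namespace SimpleGraph

section Folding

variable {V : Type*} {Δ : SimpleGraph V} {a : Δ ≃g Δ}

lemma zpow_toEquiv (m : ℤ) (v : V) : (a.toEquiv ^ m) v = a ^ m • v :=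
  congrFun (congrArg DFunLike.coe (map_zpow (MulAction.toPermHom (Δ ≃g Δ) V) a m)).symm v

lemma orbits_mk_eq_iff {v w : V} :
    (Quotient.mk _ v : Orbits a) = Quotient.mk _ w ↔ ∃ m : ℤ, a ^ m • v = w := by
  rw [Quotient.eq]
  exact exists_congr fun m => by rw [zpow_toEquiv]

lemma orbits_mk_smul (m : ℤ) (v : V) :
    (Quotient.mk _ (a ^ m • v) : Orbits a) = Quotient.mk _ v :=
  (orbits_mk_eq_iff.2 ⟨m, rfl⟩).symm

lemma cartanMatrix_comm (i j : V) : Δ.cartanMatrix i j = Δ.cartanMatrix j i := by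
  classical simp [cartanMatrix, eq_comm, adj_comm]

lemma cartanMatrix_of_ne {i j : V} (h : i ≠ j) :
    Δ.cartanMatrix i j = open Classical in if Δ.Adj i j then -1 else 0 := by
  classical rw [cartanMatrix, Matrix.of_apply, if_neg h]

lemma cartanMatrix_smul (g : Δ ≃g Δ) (i j : V) :
    Δ.cartanMatrix (g • i) (g • j) = Δ.cartanMatrix i j := by
  classical
  simp only [cartanMatrix, Matrix.of_apply, smul_adj_smul, (MulAction.injective g).eq_iff]

lemma IsDynkin.connected [Finite V] (h : Δ.IsDynkin) : Δ.Connected := by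
  have h1 := IsDynkinCartanMatrix.connected h
  convert h1
  ext i j
  classical
  by_cases hij : i = j
  · simp [hij]
  · simp [hij, cartanMatrix, Matrix.of_apply, Ne.symm hij, adj_comm]

variable [Fintype V]

lemma mem_orbitVertices {x : Orbits a} {v : V} :
    v ∈ orbitVertices a x ↔ (Quotient.mk _ v : Orbits a) = x := by
  classical simp [orbitVertices]

lemma card_orbitVertices_pos (x : Orbits a) : 0 < (orbitVertices a x).card := by
  induction x using Quotient.inductionOn with
  | h v => exact Finset.card_pos.2 ⟨v, mem_orbitVertices.2 rfl⟩

lemma foldDoublePrime_apply (x y : Orbits a) : foldDoublePrime a x y = foldPrime a y x := by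
  simp only [foldDoublePrime, foldPrime, Matrix.of_apply]
  rw [Finset.sum_comm]
  simp only [cartanMatrix_comm (Δ := Δ)]

lemma card_mul_foldPrime (x y : Orbits a) :
    ((orbitVertices a x).card : ℚ) * foldPrime a x y =
      ((orbitVertices a y).card : ℚ) * foldPrime a y x := by
  have h := fun x : Orbits a => (Nat.cast_ne_zero (R := ℚ)).2 (card_orbitVertices_pos x).ne'
  rw [foldPrime, Matrix.of_apply, Matrix.of_apply, ← mul_assoc, mul_one_div_cancel (h x),
    ← mul_assoc, mul_one_div_cancel (h y), one_mul, one_mul, Finset.sum_comm]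
  simp_rw [cartanMatrix_comm (Δ := Δ)]

/-- The row sum over an orbit is invariant under `a`, so averaging over the orbit of `v` changes
nothing. -/
lemma foldPrime_mk (v : V) (y : Orbits a) :
    foldPrime a (Quotient.mk _ v) y = ∑ w ∈ orbitVertices a y, (Δ.cartanMatrix v w : ℚ) := by
  have h : ∀ v' ∈ orbitVertices a (Quotient.mk _ v),
      ∑ w ∈ orbitVertices a y, (Δ.cartanMatrix v' w : ℚ) =
        ∑ w ∈ orbitVertices a y, (Δ.cartanMatrix v w : ℚ) := fun v' hv' => by
    obtain ⟨m, rfl⟩ := orbits_mk_eq_iff.1 (mem_orbitVertices.1 hv').symm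
    refine (Finset.sum_equiv (MulAction.toPerm (a ^ m)) (fun w => ?_) fun w _ => ?_).symm
    · rw [mem_orbitVertices, mem_orbitVertices, MulAction.toPerm_apply, orbits_mk_smul]
    · rw [MulAction.toPerm_apply, cartanMatrix_smul]
  rw [foldPrime, Matrix.of_apply, Finset.sum_congr rfl h, Finset.sum_const, nsmul_eq_mul,
    ← mul_assoc, one_div_mul_cancel, one_mul]
  exact Nat.cast_ne_zero.2 (card_orbitVertices_pos _).ne'

/-- The map to the folded diagram is a folding in the combinatorial sense. -/
lemma IsAdmissible.isFolding {I : Type*} {C : Matrix I I ℤ} (ha : IsAdmissible a)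
    {G : SimpleGraph I} (hG : ∀ i j, G.Adj i j ↔ i ≠ j ∧ C i j ≠ 0)
    (hone : ∀ i j, G.Adj i j → C i j = -1 ∨ C j i = -1)
    (e : Orbits a ≃ I) (he : ∀ x y, foldPrime a x y = (C (e x) (e y) : ℚ)) :
    IsFolding a G (fun i j => (C i j).natAbs) (fun v => e (Quotient.mk _ v)) := by
  classical
  -- Between different orbits all Cartan entries are 0 or -1, so the folded entry counts neighbours
  -- with a minus sign.
  have hcard : ∀ v j, e (Quotient.mk _ v) ≠ j →
      C (e (Quotient.mk _ v)) j = -({w | e (Quotient.mk _ w) = j ∧ Δ.Adj v w}.ncard : ℤ) := by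
    intro v j hj
    obtain ⟨y, rfl⟩ := e.surjective j
    have h1 := (he (Quotient.mk _ v) y).symm.trans (foldPrime_mk v y)
    have h2 : {w | e (Quotient.mk _ w) = e y ∧ Δ.Adj v w} =
        ((orbitVertices a y).filter fun w => Δ.Adj v w : Finset V) := by
      ext w
      simp [mem_orbitVertices]
    have h3 : ∀ w ∈ orbitVertices a y, (Δ.cartanMatrix v w : ℚ) =
        -(if Δ.Adj v w then 1 else 0) := fun w hw => by
      rw [cartanMatrix_of_ne]
      · split_ifs <;> simp
      · rintro rfl
        exact hj (congrArg e (mem_orbitVertices.1 hw))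
    rw [Finset.sum_congr rfl h3, Finset.sum_neg_distrib, Finset.sum_boole] at h1
    rw [h2, Set.ncard_coe_finset]
    exact_mod_cast h1
  have hfib : ∀ x, ((fun v => e (Quotient.mk _ v)) ⁻¹' {e x}) = (orbitVertices a x : Set V) := by
    intro x
    ext v
    simp [mem_orbitVertices]
  refine ⟨?_, ?_, ?_, ?_, ?_, ?_, ?_⟩
  · exact e.surjective.comp Quotient.mk_surjective
  · intro v w
    rw [e.injective.eq_iff, orbits_mk_eq_iff]
  · intro v j h
    rw [hcard v j ((hG _ _).1 h).1, Int.natAbs_neg, Int.natAbs_natCast]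
  · intro v w h
    have hne : e (Quotient.mk _ v) ≠ e (Quotient.mk _ w) := fun h1 =>
      ha v w (Quotient.eq.1 (e.injective h1)) h
    refine (hG _ _).2 ⟨hne, ?_⟩
    rw [hcard v _ hne, neg_ne_zero, Nat.cast_ne_zero]
    exact Set.ncard_ne_zero_of_mem (a := w) ⟨rfl, h⟩
  · intro i j h
    exact Int.natAbs_pos.2 ((hG _ _).1 h).2
  · intro i j h
    rcases hone i j h with h1 | h1
    · exact Or.inl (by simp [h1])
    · exact Or.inr (by simp [h1])
  · intro i j
    obtain ⟨x, rfl⟩ := e.surjective i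
    obtain ⟨y, rfl⟩ := e.surjective j
    have h := card_mul_foldPrime x y
    rw [he, he] at h
    rw [hfib, hfib, Set.ncard_coe_finset, Set.ncard_coe_finset]
    have h' : ((orbitVertices a x).card : ℤ) * C (e x) (e y) =
      (orbitVertices a y).card * C (e y) (e x) := by exact_mod_cast h
    simpa [Int.natAbs_mul] using congrArg Int.natAbs h'

end Folding

end SimpleGraph

theorem mainTheorem6
    (k : Type u) [Field k] [IsAlgClosed k]
    {I I₁ I₂ : Type v} [Finite I] [Fintype I₁] [Fintype I₂]
    (C : Matrix I I ℤ) (hC : IsDynkinCartanMatrix C)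
    (Δ₁ : SimpleGraph I₁) (hΔ₁ : Δ₁.IsDynkin)
    (Δ₂ : SimpleGraph I₂) (hΔ₂ : Δ₂.IsDynkin)
    (a₁ : Δ₁ ≃g Δ₁) (ha₁ : SimpleGraph.IsAdmissible a₁)
    (a₂ : Δ₂ ≃g Δ₂) (ha₂ : SimpleGraph.IsAdmissible a₂)
    (hC₁ : IsCartanMatrixOf (SimpleGraph.foldPrime a₁) C)
    (hC₂ : IsCartanMatrixOf (SimpleGraph.foldDoublePrime a₂) C)
    (hn : (orderOf a₁ : k) ≠ 0)
    (Q₁ : CompatibleOrientation Δ₁ a₁) (Q₂ : CompatibleOrientation Δ₂ a₂) :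
    ∃ Φ : FinDimModuleCat.{max u v} k (Q₁.skewGroupAlgebra k) ⥤
        FinDimModuleCat.{max u v} k (Q₂.preprojectiveAlgebra k),
      Φ.IsEquivalence ∧ Φ.Linear k := by
  have := Fintype.ofFinite I
  have hord : orderOf a₁ ≠ 0 := fun h => hn (by rw [h, Nat.cast_zero])
  have : Finite (Subgroup.zpowers a₁) := finite_zpowers.2 (orderOf_ne_zero_iff.1 hord)
  have := Fintype.ofFinite (Subgroup.zpowers a₁)
  obtain ⟨e₁, he₁⟩ := hC₁
  obtain ⟨e₂, he₂⟩ := hC₂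
  have F₁ := ha₁.isFolding (C := C) (G := cartanGraph C) (fun i j => hC.adj_iff)
    (fun i j => hC.entry_eq_neg_one) e₁ he₁
  -- The folding C'' is the transpose of C', so Δ₂ is a C'-folding onto the transpose of `C`, with
  -- the same underlying graph.
  have F₂ := ha₂.isFolding (C := C.transpose) (G := cartanGraph C)
    (fun i j => by rw [Matrix.transpose_apply, Ne, Ne, ← hC.symm_zero]; exact hC.adj_iff)
    (fun i j h => hC.entry_eq_neg_one h.symm) e₂
    (fun x y => (SimpleGraph.foldDoublePrime_apply y x).symm.trans (he₂ y x))
  obtain ⟨D⟩ := F₁.nonempty_orbitDuality (k := k) F₂ hC.isTree hΔ₂.connected hn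
  exact OrbitDuality.exists_equivalence Q₁ Q₂ D
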